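/- **Asymptotic Bernstein–von Mises theorem for GLMs.** For every integer $n\ge1$ let $d_n,k_n$ be dimensions with $d_n\ge1$, let $X_{1,n},\dots,X_{n,n}\in\mathbb R^{d_n\times k_n}$ be (deterministic) matrices, and let $\mu_n$ be a base measure on $\mathbb R^{k_n}$. Put $$\Omega_n=\Big\{\omega\in\mathbb R^{k_n}:\int e^{\omega^\top y}\,d\mu_n(y)<\infty\Big\},\qquad \psi_n(\omega)=\log\int e^{\omega^\top y}\,d\mu_n(y),\qquad p_n(y\mid\omega)=e^{\omega^\top y-\psi_n(\omega)},$$ and assume that the exponential family is regular ($\Omega_n$ is open) and minimal ($\mu_n$ is not concentrated on an affine hyperplane of $\mathbb R^{k_n}$). Let $\Theta_n=\{\theta\in\mathbb R^{d_n}: X_{i,n}^\top\theta\in\Omega_n,\ i=1,\dots,n\}$, let $\theta_n^*\in\Theta_n$ be the ground truth, and let $Y_1,\dots,Y_n$ be independent with $Y_i\sim p_n(\cdot\mid X_{i,n}^\top\theta^*_n)\,d\mu_n$. Let $\varpi_n$ be a (possibly improper) measurable prior density which is strictly positive on $\Theta_n$. Define the normalized negative log likelihood $\ell_n(\theta)=-\frac1n\log\prod_{i=1}^np_n(Y_i\mid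 X_{i,n}^\top\theta)$, the posterior density $\pi_{v_n}(\theta)\propto e^{-n\ell_n(\theta)}\varpi_n(\theta)$ on $\Theta_n$ (zero outside $\Theta_n$), the maximum likelihood estimator $\hat\theta_n=\arg\min_{\Theta_n}\ell_n$, the Fisher information matrix $$F_n^*=\frac1n\sum_{i=1}^nX_{i,n}\nabla^2\psi_n(X_{i,n}^\top\theta_n^*)X_{i,n}^\top,$$ and $\gamma_n^*=\mathcal N(\hat\theta_n,(nF_n^*)^{-1})$. Write $|u|_{F}=(u^\top Fu)^{1/2}$ and $\|g\|_F=\sup_{|u|_F=1}g^\top u$, and for $s\ge0$ let $$\mathcal U_n^*(s)=\{\theta\in\mathbb R^{d_n}:|\theta-\theta_n^*|_{F_n^*}\le s\sqrt{d_n/n}\},\qquad \delta^*_{01n}(s)=\sup_{\theta\in\mathcal U_n^*(s)}\|\nabla\log\varpi_n(\theta)\|_{F_n^*},\qquad M_{0n}^*=\frac1{d_n}\log\sup_{\theta\in\Theta_n}\frac{\varpi_n(\theta)}{\varpi_n(\theta_n^*)},$$ with $\delta^*_{01n}(s)=\infty$ if $\varpi_n$ is not $C^1$ (at every point) or not strictly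 positive on $\mathcal U_n^*(s)$, and $$\delta^*_{3n}(s)=\sup_{\theta\in\mathcal U_n^*(s),\,u\ne0}\frac{\frac1n\sum_{i=1}^n\langle\nabla^3\psi_n(X_{i,n}^\top\theta),(X_{i,n}^\top u)^{\otimes3}\rangle}{\Big(\frac1n\sum_{i=1}^n\langle\nabla^2\psi_n(X_{i,n}^\top\theta_n^*),(X_{i,n}^\top u)^{\otimes2}\rangle\Big)^{3/2}}.$$ Suppose that for each $n$ the columns of $X_{1,n},\dots,X_{n,n}$ span $\mathbb R^{d_n}$, that $M^*_{0n}=O(1)$ as $n\to\infty$, and that for each fixed $s\ge0$: (1) $\mathcal U_n^*(s)\subset\Theta_n$ for all large enough $n$; (2) $\delta^*_{01n}(s)=o(\sqrt n)$; (3) $\delta^*_{3n}(s)\,d_n/\sqrt n=o(1)$. Then $\mathrm{TV}(\pi_{v_n},\gamma_n^*)\to0$ with probability tending to $1$. That is, for every $\varepsilon>0$ there are events $A_n$ in the space of $(Y_1,\dots,Y_n)$, whose probability tends to $1$ as $n\to\infty$, such that on $A_n$ the MLE $\hat\theta_n$ exists and is unique, the posterior $\pi_{v_n}$ is a well-defined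 probability measure, and $\mathrm{TV}(\pi_{v_n},\gamma_n^*)\le\varepsilon$, where $\mathrm{TV}(P,Q)=\sup_A|P(A)-Q(A)|$ over Borel sets $A$. -/

import Mathlib

open MeasureTheory ProbabilityTheory Filter Topology
open scoped ENNReal Matrix

noncomputable section

/-- Total variation distance `sup_A |μ(A) - ν(A)|` over measurable sets `A`
(a supremum of numbers in `[0, 1]` for probability measures). -/
def tvDist {α : Type*} [MeasurableSpace α] (μ ν : Measure α) : ℝ :=
  ⨆ A : {A : Set α // MeasurableSet A}, |μ.real A - ν.real A|

/-- Hessian matrix `∇² f(x)`. -/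
def hessian {k : ℕ} (f : EuclideanSpace ℝ (Fin k) → ℝ) (x : EuclideanSpace ℝ (Fin k)) :
    Matrix (Fin k) (Fin k) ℝ :=
  Matrix.of fun a b =>
    iteratedFDeriv ℝ 2 f x ![EuclideanSpace.single a 1, EuclideanSpace.single b 1]

/-- `|u|_A = |A^{1/2} u| = (uᵀ A u)^{1/2}` for a positive definite matrix `A`. -/
def wnorm {d : ℕ} (A : Matrix (Fin d) (Fin d) ℝ) (u : EuclideanSpace ℝ (Fin d)) : ℝ :=
  √(u.ofLp ⬝ᵥ A *ᵥ u.ofLp)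

/-- `‖g‖_A = sup_{|u|_A = 1} ⟨g, u⟩` for a vector `g`. The supremum runs over a symmetric set,
so replacing negative values of `⟨g, u⟩` by zero does not change it. -/
def dualNorm {d : ℕ} (A : Matrix (Fin d) (Fin d) ℝ) (g : EuclideanSpace ℝ (Fin d)) : ℝ≥0∞ :=
  ⨆ (u : EuclideanSpace ℝ (Fin d)) (_ : wnorm A u = 1), ENNReal.ofReal (inner ℝ g u)

namespace ExpFam

variable {k : ℕ} (μ : Measure (EuclideanSpace ℝ (Fin k)))

/-- The full natural parameter domain `Ω = {ω | ∫ exp(ωᵀ y) dμ(y) < ∞}`. -/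
def Omega : Set (EuclideanSpace ℝ (Fin k)) :=
  {ω | Integrable (fun y => Real.exp (inner ℝ ω y)) μ}

/-- `ψ(ω) = log ∫ exp(ωᵀ y) dμ(y)`. -/
def psi (ω : EuclideanSpace ℝ (Fin k)) : ℝ :=
  Real.log (∫ y, Real.exp (inner ℝ ω y) ∂μ)

/-- The density `p(y | ω) = exp(ωᵀ y - ψ(ω))` with respect to `μ`. -/
def density (ω y : EuclideanSpace ℝ (Fin k)) : ℝ :=
  Real.exp (inner ℝ ω y - psi μ ω)

/-- The family is regular: its natural parameter domain is open. -/
def IsRegular : Prop := IsOpen (Omega μ)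

/-- The family is minimal: `μ` is not carried by an affine hyperplane of `ℝᵏ`. (For a regular
family with non-empty `Ω`, the parameters `ω` satisfy no affine relation either.) -/
def IsMinimal : Prop :=
  ∀ u : EuclideanSpace ℝ (Fin k), u ≠ 0 → ∀ c : ℝ, ¬ ∀ᵐ y ∂μ, inner ℝ u y = c

end ExpFam

/-- The data of a Bayesian generalized linear model with `n` observations, parameter in `ℝᵈ` and
labels in `ℝᵏ`: design matrices `X₁, …, Xₙ`, base measure, ground truth parameter, and
prior density (of which only the values on the parameter domain matter). -/
structure GLM (n d k : ℕ) where
  X : Fin n → Matrix (Fin d) (Fin k) ℝ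
  base : Measure (EuclideanSpace ℝ (Fin k))
  truth : EuclideanSpace ℝ (Fin d)
  prior : EuclideanSpace ℝ (Fin d) → ℝ

namespace GLM

variable {n d k : ℕ} (M : GLM n d k)

/-- The linear predictor `X_iᵀ θ`. -/
def pred (i : Fin n) (θ : EuclideanSpace ℝ (Fin d)) : EuclideanSpace ℝ (Fin k) :=
  Matrix.toEuclideanLin (M.X i)ᵀ θ

/-- `Θ = {θ | X_iᵀ θ ∈ Ω for all i}`. -/
def Theta : Set (EuclideanSpace ℝ (Fin d)) :=
  {θ | ∀ i, M.pred i θ ∈ ExpFam.Omega M.base}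

/-- The law of `(Y₁, …, Yₙ)` under `θ`: independent, with `Y_i ∼ p(· | X_iᵀ θ) dμ`. -/
def law (θ : EuclideanSpace ℝ (Fin d)) : Measure (Fin n → EuclideanSpace ℝ (Fin k)) :=
  Measure.pi fun i =>
    M.base.withDensity fun y => ENNReal.ofReal (ExpFam.density M.base (M.pred i θ) y)

/-- The normalized negative log likelihood `ℓ(θ) = -(1/n) log ∏ᵢ p(Y_i | X_iᵀ θ)`. -/
def nll (Y : Fin n → EuclideanSpace ℝ (Fin k)) (θ : EuclideanSpace ℝ (Fin d)) : ℝ :=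
  -(n : ℝ)⁻¹ * Real.log (∏ i, ExpFam.density M.base (M.pred i θ) (Y i))

/-- `θhat` is the unique maximum likelihood estimator over `Θ`. -/
def IsUniqueMLE (Y : Fin n → EuclideanSpace ℝ (Fin k)) (θhat : EuclideanSpace ℝ (Fin d)) : Prop :=
  θhat ∈ M.Theta ∧ ∀ θ ∈ M.Theta, θ ≠ θhat → M.nll Y θhat < M.nll Y θ

/-- The unnormalized posterior: density `exp(-n ℓ(θ)) prior(θ)` on `Θ`. -/
def unnormPosterior (Y : Fin n → EuclideanSpace ℝ (Fin k)) :
    Measure (EuclideanSpace ℝ (Fin d)) :=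
  (volume.restrict M.Theta).withDensity fun θ =>
    ENNReal.ofReal (Real.exp (-(n : ℝ) * M.nll Y θ) * M.prior θ)

/-- The posterior `π_v`. It is a probability measure exactly when the
total mass of `unnormPosterior` is neither zero nor infinite. -/
def posterior (Y : Fin n → EuclideanSpace ℝ (Fin k)) : Measure (EuclideanSpace ℝ (Fin d)) :=
  (M.unnormPosterior Y Set.univ)⁻¹ • M.unnormPosterior Y

/-- The Fisher information matrix `F* = (1/n) ∑ᵢ X_i ∇²ψ(X_iᵀ θ*) X_iᵀ`. -/
def fisher : Matrix (Fin d) (Fin d) ℝ :=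
  (n : ℝ)⁻¹ • ∑ i, M.X i * hessian (ExpFam.psi M.base) (M.pred i M.truth) * (M.X i)ᵀ

/-- `γ* = N(θhat, (n F*)⁻¹)`. -/
def bvmGaussian (θhat : EuclideanSpace ℝ (Fin d)) : Measure (EuclideanSpace ℝ (Fin d)) :=
  multivariateGaussian θhat ((n : ℝ) • M.fisher)⁻¹

/-- `U*(s) = {θ | |θ - θ*|_{F*} ≤ s √(d/n)}`. -/
def nbhd (s : ℝ) : Set (EuclideanSpace ℝ (Fin d)) :=
  {θ | wnorm M.fisher (θ - M.truth) ≤ s * √((d : ℝ) / n)}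

open Classical in
/-- `δ*₀₁(s) = sup_{θ ∈ U*(s)} ‖∇ log prior(θ)‖_{F*}`, and `∞` if the prior is not `C¹` or not
strictly positive on `U*(s)`. -/
def delta01 (s : ℝ) : ℝ≥0∞ :=
  if ∀ θ ∈ M.nbhd s, ContDiffAt ℝ 1 M.prior θ ∧ 0 < M.prior θ then
    ⨆ θ ∈ M.nbhd s, dualNorm M.fisher (gradient (fun t => Real.log (M.prior t)) θ)
  else ∞

/-- `M₀* = d⁻¹ log sup_{θ ∈ Θ} prior(θ) / prior(θ*)`, possibly `+∞`. -/
def M0 : EReal :=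
  ENNReal.log (⨆ θ ∈ M.Theta, ENNReal.ofReal (M.prior θ / M.prior M.truth)) / (d : EReal)

/-- `δ*₃(s)`: the supremum over `θ ∈ U*(s)` and `u ≠ 0` of
`(1/n) ∑ᵢ ⟨∇³ψ(X_iᵀ θ), (X_iᵀ u)^{⊗3}⟩` divided by
`((1/n) ∑ᵢ ⟨∇²ψ(X_iᵀ θ*), (X_iᵀ u)^{⊗2}⟩)^{3/2}`. The ratio is odd in `u`, so
replacing its negative values by zero does not change the supremum. -/
def delta3 (s : ℝ) : ℝ≥0∞ :=
  ⨆ (θ ∈ M.nbhd s) (u : EuclideanSpace ℝ (Fin d)) (_ : u ≠ 0),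
    ENNReal.ofReal
      (((n : ℝ)⁻¹ * ∑ i,
          iteratedFDeriv ℝ 3 (ExpFam.psi M.base) (M.pred i θ) (fun _ => M.pred i u)) /
        ((n : ℝ)⁻¹ * ∑ i,
          iteratedFDeriv ℝ 2 (ExpFam.psi M.base) (M.pred i M.truth)
            (fun _ => M.pred i u)) ^ (3 / 2 : ℝ))

/-- The event that the unique MLE exists, the posterior is a probability measure, and
`TV(π_v, γ*) ≤ ε`. -/
def bvmEvent (ε : ℝ) : Set (Fin n → EuclideanSpace ℝ (Fin k)) :=
  {Y | ∃ θhat, M.IsUniqueMLE Y θhat ∧ IsProbabilityMeasure (M.posterior Y) ∧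
    tvDist (M.posterior Y) (M.bvmGaussian θhat) ≤ ε}

end GLM

end

/-!
In the coordinates `z ↦ θ* + (n F*)^{-1/2} z` the Hessian of the unnormalized negative log
likelihood is the identity at the origin, and the score has identity covariance, so by Chebyshev's
inequality it is at most `r √d` off an event of probability `1 / r ^ 2`. On the ball of radius
`s √d` the smallness of `δ₃*` keeps the Hessian close to the identity and the smallness of `δ₀₁*`
keeps the log prior almost constant. If `s` is large compared to `r`, the minimizer `y` of the
negative log likelihood lies in the ball, and convexity makes the likelihood decay exponentially
outside of it, which the bound `M₀*` on the prior cannot compensate: the outside is negligible both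
for the posterior and for the Gaussian centred at `y`. On the ball, the square root of the density
of the posterior with respect to this Gaussian is the exponential of a function with small
Lipschitz constant, so by the Gaussian Poincaré inequality it is nearly constant in `L²`, and the
two measures are close in total variation.
-/

section StandardGaussian

variable {E : Type*} [NormedAddCommGroup E] [InnerProductSpace ℝ E] [FiniteDimensional ℝ E]
  [MeasurableSpace E] [BorelSpace E]

lemma integrable_exp_neg_half_sq_norm :
    Integrable (fun x : E => Real.exp (-‖x‖ ^ 2 / 2)) := by
  have h := (GaussianFourier.integrable_cexp_neg_mul_sq_norm_add (V := E) (b := (1 / 2 : ℂ))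
    (by norm_num) 0 0).re
  refine h.congr (ae_of_all _ fun x => ?_)
  have hx : (-(1 / 2 : ℂ) * (‖x‖ : ℂ) ^ 2 + 0 * ((inner ℝ (0 : E) x : ℝ) : ℂ)) =
      ((-‖x‖ ^ 2 / 2 : ℝ) : ℂ) := by
    push_cast; ring
  simp only [hx]
  exact Complex.exp_ofReal_re _

lemma integral_cexp_neg_half_sq_norm_add_I_mul_inner (t : E) :
    ∫ x : E, Complex.exp (-(1 / 2 : ℂ) * ‖x‖ ^ 2 + Complex.I * (inner ℝ t x : ℝ)) =
      (∫ x : E, Real.exp (-‖x‖ ^ 2 / 2) : ℝ) * Complex.exp (-‖t‖ ^ 2 / 2) := by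
  have hzero := GaussianFourier.integral_cexp_neg_mul_sq_norm_add (V := E) (b := (1 / 2 : ℂ))
    (by norm_num) 0 0
  have hreal : ((∫ x : E, Real.exp (-‖x‖ ^ 2 / 2) : ℝ) : ℂ) =
      ∫ x : E, Complex.exp (-(1 / 2 : ℂ) * ‖x‖ ^ 2 + 0 * (inner ℝ (0 : E) x : ℝ)) := by
    rw [← integral_complex_ofReal]
    congr 1 with x
    push_cast
    ring_nf
  rw [hreal, hzero, GaussianFourier.integral_cexp_neg_mul_sq_norm_add (by norm_num)]
  simp only [ne_eq, OfNat.ofNat_ne_zero, not_false_eq_true, zero_pow, norm_zero,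
    Complex.ofReal_zero, mul_zero, zero_div, Complex.exp_zero, mul_one, Complex.I_sq]
  ring_nf

lemma stdGaussian_eq_withDensity :
    stdGaussian E = volume.withDensity fun x => ENNReal.ofReal
      ((∫ z : E, Real.exp (-‖z‖ ^ 2 / 2))⁻¹ * Real.exp (-‖x‖ ^ 2 / 2)) := by
  set I : ℝ := ∫ x : E, Real.exp (-‖x‖ ^ 2 / 2) with hI
  have hIpos : 0 < I := integral_exp_pos integrable_exp_neg_half_sq_norm
  have : IsFiniteMeasure (volume.withDensity fun x : E =>
      ENNReal.ofReal (I⁻¹ * Real.exp (-‖x‖ ^ 2 / 2))) :=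
    isFiniteMeasure_withDensity_ofReal (integrable_exp_neg_half_sq_norm.const_mul _).2
  refine Measure.ext_of_charFun (funext fun t => ?_)
  have hintegrand (x : E) : (ENNReal.ofReal (I⁻¹ * Real.exp (-‖x‖ ^ 2 / 2))).toReal •
      Complex.exp ((inner ℝ x t : ℝ) * Complex.I) =
      (I⁻¹ : ℂ) * Complex.exp (-(1 / 2 : ℂ) * ‖x‖ ^ 2 + Complex.I * (inner ℝ t x : ℝ)) := by
    rw [ENNReal.toReal_ofReal (by positivity), real_inner_comm, Complex.exp_add,
      Complex.real_smul]
    push_cast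
    ring_nf
  rw [charFun_stdGaussian, charFun_apply,
    integral_withDensity_eq_integral_toReal_smul (by fun_prop) (by simp)]
  simp_rw [hintegrand]
  rw [integral_const_mul, integral_cexp_neg_half_sq_norm_add_I_mul_inner, ← hI, ← mul_assoc,
    inv_mul_cancel₀ (by exact_mod_cast hIpos.ne'), one_mul]

lemma stdGaussian_absolutelyContinuous : stdGaussian E ≪ (volume : Measure E) := by
  rw [stdGaussian_eq_withDensity]
  exact withDensity_absolutelyContinuous _ _

lemma integral_sq_dual_stdGaussian (ℓ : E →L[ℝ] ℝ) :
    ∫ y, (ℓ y) ^ 2 ∂(stdGaussian E) = ‖ℓ‖ ^ 2 := by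
  rw [← variance_dual_stdGaussian ℓ, variance_of_integral_eq_zero (by fun_prop)]
  exact integral_strongDual_stdGaussian ℓ

lemma integral_sq_norm_stdGaussian :
    ∫ y, ‖y‖ ^ 2 ∂(stdGaussian E) = Module.finrank ℝ E := by
  let b := stdOrthonormalBasis ℝ E
  have hnorm (y : E) : ‖y‖ ^ 2 = ∑ i, (innerSL ℝ (b i) y) ^ 2 := by
    simpa [innerSL_apply_apply ℝ] using (b.sum_sq_inner_right y).symm
  simp_rw [hnorm]
  rw [integral_finsetSum _ fun i _ =>
    (IsGaussian.memLp_dual _ (innerSL ℝ (b i)) 2 (by simp)).integrable_sq]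
  simp_rw [integral_sq_dual_stdGaussian]
  simp

lemma measurePreserving_rotation_stdGaussian (a : ℝ) :
    MeasurePreserving (ContinuousLinearMap.rotation (E := E) a)
      ((stdGaussian E).prod (stdGaussian E)) ((stdGaussian E).prod (stdGaussian E)) :=
  ⟨by fun_prop, IsGaussian.map_rotation_eq_self (by simp) a⟩

lemma memLp_two_stdGaussian_of_lipschitzWith {w : E → ℝ} {K : NNReal} (hw : LipschitzWith K w) :
    MemLp w 2 (stdGaussian E) := by
  have hsub : LipschitzWith K fun x => w x - w 0 := by
    simpa using hw.sub (LipschitzWith.const (w 0))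
  have hmem := hsub.comp_memLp (by simp) (IsGaussian.memLp_two_id (μ := stdGaussian E))
  exact (hmem.add (memLp_const (w 0))).ae_eq (ae_of_all _ fun x => by simp)

end StandardGaussian

section Poincare

lemma integral_sq_sub_prod {Ω : Type*} [MeasurableSpace Ω] {μ : Measure Ω}
    [IsProbabilityMeasure μ] {w : Ω → ℝ} (hw : MemLp w 2 μ) :
    ∫ p, (w p.1 - w p.2) ^ 2 ∂(μ.prod μ) = 2 * Var[w; μ] := by
  have hint : Integrable w μ := hw.integrable (by norm_num)
  have hmean : ∫ p, (w p.1 - w p.2) ∂(μ.prod μ) = 0 := by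
    rw [integral_sub (hint.comp_fst _) (hint.comp_snd _), integral_fun_fst, integral_fun_snd]
    simp
  have hvar := variance_add_prod hw hw.neg
  simp only [Pi.neg_apply, ← sub_eq_add_neg, variance_neg] at hvar
  rw [← two_mul] at hvar
  rw [← hvar]
  exact (variance_of_integral_eq_zero
    ((hw.comp_fst μ).sub (hw.comp_snd μ)).aemeasurable hmean).symm

section Rotation

variable {E : Type*} [NormedAddCommGroup E] [NormedSpace ℝ E]

lemma norm_rotation_fst_sub_le (δ : ℝ) (p : E × E) :
    ‖(ContinuousLinearMap.rotation δ p).1 - p.1‖ ≤ |δ| * (‖p.1‖ + ‖p.2‖) := by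
  have hcos : |Real.cos δ - 1| ≤ |δ| := by simpa using Real.abs_cos_sub_cos_le δ 0
  have hsin : |Real.sin δ| ≤ |δ| := Real.abs_sin_le_abs
  calc ‖(ContinuousLinearMap.rotation δ p).1 - p.1‖
      = ‖(Real.cos δ - 1) • p.1 + Real.sin δ • p.2‖ := by
        rw [ContinuousLinearMap.rotation_apply]; congr 1; module
    _ ≤ |Real.cos δ - 1| * ‖p.1‖ + |Real.sin δ| * ‖p.2‖ := by
        refine (norm_add_le _ _).trans ?_
        rw [norm_smul, norm_smul, Real.norm_eq_abs, Real.norm_eq_abs]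
    _ ≤ |δ| * (‖p.1‖ + ‖p.2‖) := by
        rw [mul_add]; gcongr

lemma rotation_add_apply (a b : ℝ) (p : E × E) :
    ContinuousLinearMap.rotation (a + b) p =
      ContinuousLinearMap.rotation a (ContinuousLinearMap.rotation b p) := by
  simp only [ContinuousLinearMap.rotation_apply, Real.cos_add, Real.sin_add]
  ext <;> module

lemma sq_sub_le_sum_rotation (w : E → ℝ) {N : ℕ} (hN : 0 < N) (p : E × E) :
    let g (j : ℕ) : ℝ := w (ContinuousLinearMap.rotation (j * (Real.pi / 2 / N)) p).1
    (w p.1 - w p.2) ^ 2 ≤ N * ∑ j ∈ Finset.range N, (g (j + 1) - g j) ^ 2 := by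
  intro g
  have hfirst : w p.1 = g 0 := by simp [g, ContinuousLinearMap.rotation_apply]
  have hlast : w p.2 = g N := by
    have : (N : ℝ) * (Real.pi / 2 / N) = Real.pi / 2 := by field_simp
    simp [g, this, ContinuousLinearMap.rotation_apply]
  rw [hfirst, hlast, ← neg_sub, neg_sq, ← Finset.sum_range_sub g]
  simpa using sq_sum_le_card_mul_sum_sq (s := Finset.range N) (f := fun j => g (j + 1) - g j)

/-- The rescaled increment of `w` at `p.1` when the pair `p` is rotated by the `N`-th part of a
right angle. -/
noncomputable def rotationIncrement (w : E → ℝ) (N : ℕ) (p : E × E) : ℝ :=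
  N * (w (ContinuousLinearMap.rotation (Real.pi / 2 / N) p).1 - w p.1)

lemma continuous_rotationIncrement {w : E → ℝ} (hw : Continuous w) (N : ℕ) :
    Continuous (rotationIncrement w N) := by
  unfold rotationIncrement
  fun_prop

lemma abs_rotationIncrement_le {w : E → ℝ} {K : NNReal} (hw : LipschitzWith K w) {N : ℕ}
    (hN : 0 < N) (p : E × E) :
    |rotationIncrement w N p| ≤ K * (Real.pi / 2) * (‖p.1‖ + ‖p.2‖) := by
  have : (0 : ℝ) < N := by exact_mod_cast hN
  have := Real.pi_pos
  rw [rotationIncrement, abs_mul, Nat.abs_cast, ← Real.dist_eq]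
  calc (N : ℝ) * dist (w _) (w p.1)
      ≤ N * (K * (|Real.pi / 2 / N| * (‖p.1‖ + ‖p.2‖))) := by
        gcongr
        refine (hw.dist_le_mul _ _).trans ?_
        rw [dist_eq_norm]
        gcongr
        exact norm_rotation_fst_sub_le _ _
    _ = K * (Real.pi / 2) * (‖p.1‖ + ‖p.2‖) := by
        rw [abs_of_pos (by positivity)]
        field_simp

lemma tendsto_rotationIncrement {w : E → ℝ} {p : E × E} (hw : DifferentiableAt ℝ w p.1) :
    Tendsto (fun N => rotationIncrement w N p) atTop
      (𝓝 (Real.pi / 2 * fderiv ℝ w p.1 p.2)) := by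
  have hpath : HasDerivAt (fun t : ℝ => Real.cos t • p.1 + Real.sin t • p.2) p.2 0 := by
    convert! ((Real.hasDerivAt_cos 0).smul_const p.1).add
      ((Real.hasDerivAt_sin 0).smul_const p.2) using 1
    simp
  have hderiv : HasDerivAt (fun t : ℝ => w (Real.cos t • p.1 + Real.sin t • p.2))
      (fderiv ℝ w p.1 p.2) 0 := by
    have hw0 : HasFDerivAt w (fderiv ℝ w p.1) (Real.cos 0 • p.1 + Real.sin 0 • p.2) := by
      simpa using hw.hasFDerivAt
    exact hw0.comp_hasDerivAt 0 hpath
  have hangle : Tendsto (fun N : ℕ => Real.pi / 2 / (N : ℝ)) atTop (𝓝[≠] 0) := by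
    refine tendsto_nhdsWithin_iff.2 ⟨tendsto_const_div_atTop_nhds_zero_nat _, ?_⟩
    filter_upwards [eventually_gt_atTop 0] with N hN
    have : (0 : ℝ) < N := by exact_mod_cast hN
    exact (div_pos Real.pi_div_two_pos this).ne'
  refine (((hasDerivAt_iff_tendsto_slope.1 hderiv).comp hangle).const_mul (Real.pi / 2)).congr' ?_
  filter_upwards [eventually_gt_atTop 0] with N hN
  have : (0 : ℝ) < N := by exact_mod_cast hN
  have := Real.pi_pos
  simp only [Function.comp, slope, vsub_eq_sub, sub_zero, Real.cos_zero, Real.sin_zero, one_smul,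
    zero_smul, add_zero, smul_eq_mul, rotationIncrement, ContinuousLinearMap.rotation_apply]
  field_simp

end Rotation

variable {E : Type*} [NormedAddCommGroup E] [InnerProductSpace ℝ E] [FiniteDimensional ℝ E]
  [MeasurableSpace E] [BorelSpace E]

lemma integral_sq_sub_le_rotationIncrement {w : E → ℝ} (hw : MemLp w 2 (stdGaussian E)) {N : ℕ}
    (hN : 0 < N) :
    ∫ p, (w p.1 - w p.2) ^ 2 ∂((stdGaussian E).prod (stdGaussian E)) ≤
      ∫ p, rotationIncrement w N p ^ 2 ∂((stdGaussian E).prod (stdGaussian E)) := by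
  let δ : ℝ := Real.pi / 2 / N
  set ν := (stdGaussian E).prod (stdGaussian E)
  let g (j : ℕ) (p : E × E) : ℝ := w (ContinuousLinearMap.rotation (j * δ) p).1
  have hg (j : ℕ) : MemLp (g j) 2 ν := hw.comp_measurePreserving
    (measurePreserving_fst.comp (measurePreserving_rotation_stdGaussian (j * δ)))
  have hw₁ : MemLp (fun p : E × E => w p.1) 2 ν := hw.comp_fst _
  have hgi (j : ℕ) : Integrable (fun p => (g (j + 1) p - g j p) ^ 2) ν :=
    ((hg (j + 1)).sub (hg j)).integrable_sq
  have hstep (j : ℕ) : ∫ p, (g (j + 1) p - g j p) ^ 2 ∂ν = ∫ p, (g 1 p - w p.1) ^ 2 ∂ν := by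
    have hrot : MeasurePreserving (ContinuousLinearMap.rotation (E := E) (j * δ)) ν ν :=
      measurePreserving_rotation_stdGaussian _
    have hmap := integral_map hrot.aemeasurable
      (hrot.map_eq.symm ▸ ((hg 1).sub hw₁).integrable_sq.aestronglyMeasurable)
    rw [hrot.map_eq] at hmap
    simp only [Pi.sub_apply] at hmap
    rw [hmap]
    simp only [g, ← rotation_add_apply]
    push_cast
    ring_nf
  calc ∫ p, (w p.1 - w p.2) ^ 2 ∂ν
      ≤ ∫ p, N * ∑ j ∈ Finset.range N, (g (j + 1) p - g j p) ^ 2 ∂ν :=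
        integral_mono_of_nonneg (ae_of_all _ fun p => by positivity)
          ((integrable_finsetSum _ fun j _ => hgi j).const_mul _)
            (ae_of_all _ (sq_sub_le_sum_rotation w hN))
    _ = ∫ p, rotationIncrement w N p ^ 2 ∂ν := by
        rw [integral_const_mul, integral_finsetSum _ fun j _ => hgi j]
        simp_rw [hstep, rotationIncrement, mul_pow, integral_const_mul, g, Nat.cast_one, one_mul]
        simp only [Finset.sum_const, Finset.card_range, nsmul_eq_mul]
        ring

lemma integrable_sq_norm_add_norm_stdGaussian :
    Integrable (fun p : E × E => (‖p.1‖ + ‖p.2‖) ^ 2)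
      ((stdGaussian E).prod (stdGaussian E)) := by
  have h2 : MemLp (fun x : E => ‖x‖) 2 (stdGaussian E) := IsGaussian.memLp_two_id.norm
  exact ((h2.comp_fst _).add (h2.comp_snd _)).integrable_sq

/-- The quarter rotation carrying `p.1` to `p.2` is cut into `N` equal steps, each of which
preserves the Gaussian measure of pairs; letting `N → ∞` turns the steps into derivatives. -/
lemma integral_sq_sub_le_integral_sq_fderiv {w : E → ℝ} {K : NNReal} (hw : LipschitzWith K w) :
    let ν := (stdGaussian E).prod (stdGaussian E)
    Integrable (fun p : E × E => (Real.pi / 2 * fderiv ℝ w p.1 p.2) ^ 2) ν ∧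
      ∫ p, (w p.1 - w p.2) ^ 2 ∂ν ≤ ∫ p, (Real.pi / 2 * fderiv ℝ w p.1 p.2) ^ 2 ∂ν := by
  intro ν
  have hlim : ∀ᵐ p ∂ν, Tendsto (fun N => rotationIncrement w (N + 1) p ^ 2) atTop
      (𝓝 ((Real.pi / 2 * fderiv ℝ w p.1 p.2) ^ 2)) := by
    have hdiff : ∀ᵐ p ∂ν, DifferentiableAt ℝ w p.1 := Measure.quasiMeasurePreserving_fst.ae
      (stdGaussian_absolutelyContinuous.ae_le hw.ae_differentiableAt)
    filter_upwards [hdiff] with p hp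
    exact ((tendsto_rotationIncrement hp).pow 2).comp (tendsto_add_atTop_nat 1)
  have hmeas (N : ℕ) : AEStronglyMeasurable (fun p => rotationIncrement w N p ^ 2) ν :=
    ((continuous_rotationIncrement hw.continuous N).pow 2).aestronglyMeasurable
  have hdom := (integrable_sq_norm_add_norm_stdGaussian (E := E)).const_mul
    ((K * (Real.pi / 2)) ^ 2)
  have hbound (N : ℕ) (p : E × E) : ‖rotationIncrement w (N + 1) p ^ 2‖ ≤
      (K * (Real.pi / 2)) ^ 2 * (‖p.1‖ + ‖p.2‖) ^ 2 := by
    rw [← mul_pow, norm_pow]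
    gcongr
    exact abs_rotationIncrement_le hw N.succ_pos p
  constructor
  · refine hdom.mono' (aestronglyMeasurable_of_tendsto_ae _ (fun N => hmeas (N + 1)) hlim) ?_
    filter_upwards [hlim] with p hp
    exact le_of_tendsto hp.norm (Eventually.of_forall fun N => hbound N p)
  · exact ge_of_tendsto' (tendsto_integral_of_dominated_convergence _ (fun N => hmeas (N + 1)) hdom
      (fun N => ae_of_all _ (hbound N)) hlim) fun N =>
        integral_sq_sub_le_rotationIncrement (memLp_two_stdGaussian_of_lipschitzWith hw) N.succ_pos

lemma variance_stdGaussian_le {w ρ : E → ℝ} {K : NNReal} (hw : LipschitzWith K w)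
    (hρ : MemLp ρ 2 (stdGaussian E))
    (hwρ : ∀ x, DifferentiableAt ℝ w x → ‖fderiv ℝ w x‖ ≤ ρ x) :
    Var[w; stdGaussian E] ≤ Real.pi ^ 2 / 8 * ∫ x, ρ x ^ 2 ∂(stdGaussian E) := by
  obtain ⟨hint, hle⟩ := integral_sq_sub_le_integral_sq_fderiv hw
  rw [integral_sq_sub_prod (memLp_two_stdGaussian_of_lipschitzWith hw), integral_prod _ hint] at hle
  have hinner (x : E) : ∫ y, (Real.pi / 2 * fderiv ℝ w x y) ^ 2 ∂(stdGaussian E) =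
      Real.pi ^ 2 / 4 * ‖fderiv ℝ w x‖ ^ 2 := by
    simp only [mul_pow, integral_const_mul, integral_sq_dual_stdGaussian]
    ring
  have hmono : ∫ x, Real.pi ^ 2 / 4 * ‖fderiv ℝ w x‖ ^ 2 ∂(stdGaussian E) ≤
      ∫ x, Real.pi ^ 2 / 4 * ρ x ^ 2 ∂(stdGaussian E) := by
    have := hint.integral_prod_left
    simp only [hinner] at this
    refine integral_mono_ae this (hρ.integrable_sq.const_mul _) ?_
    filter_upwards [stdGaussian_absolutelyContinuous.ae_le hw.ae_differentiableAt] with x hx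
    have := hwρ x hx
    gcongr
  simp only [hinner] at hle
  rw [integral_const_mul (Real.pi ^ 2 / 4) fun x => ρ x ^ 2] at hmono
  linarith

lemma lipschitzWith_exp_comp {α : Type*} [PseudoMetricSpace α] {f : α → ℝ} {L : NNReal}
    (hf : LipschitzWith L f) {C : ℝ} (hC : ∀ x, f x ≤ C) :
    LipschitzWith ((Real.exp C).toNNReal * L) fun x => Real.exp (f x) := by
  have hexp : LipschitzOnWith (Real.exp C).toNNReal Real.exp (Set.Iic C) := by
    refine (convex_Iic _).lipschitzOnWith_of_nnnorm_deriv_le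
      (fun x _ => Real.differentiableAt_exp) fun x hx => ?_
    rw [Real.deriv_exp, ← NNReal.coe_le_coe, coe_nnnorm, Real.norm_eq_abs, Real.abs_exp,
      Real.coe_toNNReal _ (Real.exp_pos _).le]
    exact Real.exp_le_exp.2 hx
  rw [← lipschitzOnWith_univ] at hf ⊢
  exact hexp.comp hf fun x _ => hC x

lemma norm_fderiv_exp_comp_le {F : Type*} [NormedAddCommGroup F] [NormedSpace ℝ F] {f : F → ℝ}
    {L : NNReal} (hf : LipschitzWith L f) {x : F}
    (hx : DifferentiableAt ℝ (fun x => Real.exp (f x)) x) :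
    ‖fderiv ℝ (fun x => Real.exp (f x)) x‖ ≤ L * Real.exp (f x) := by
  have hfx : DifferentiableAt ℝ f x := by
    simpa using hx.log (Real.exp_pos _).ne'
  rw [fderiv_exp hfx, norm_smul, Real.norm_eq_abs, Real.abs_exp, mul_comm]
  gcongr
  exact norm_fderiv_le_of_lipschitz ℝ hf

lemma variance_exp_comp_stdGaussian_le {f : E → ℝ} {L : NNReal} (hf : LipschitzWith L f) {C : ℝ}
    (hC : ∀ x, f x ≤ C) :
    Var[fun x => Real.exp (f x); stdGaussian E] ≤
      Real.pi ^ 2 / 8 * L ^ 2 * ∫ x, Real.exp (f x) ^ 2 ∂(stdGaussian E) := by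
  have hexp := lipschitzWith_exp_comp hf hC
  have := variance_stdGaussian_le hexp
    ((memLp_two_stdGaussian_of_lipschitzWith hexp).const_mul (L : ℝ))
    fun x hx => norm_fderiv_exp_comp_le hf hx
  simpa only [mul_pow, integral_const_mul, ← mul_assoc] using this

end Poincare

section TotalVariation

variable {α : Type*} [MeasurableSpace α]

lemma tvDist_le {μ ν : Measure α} {ε : ℝ}
    (h : ∀ A, MeasurableSet A → |μ.real A - ν.real A| ≤ ε) : tvDist μ ν ≤ ε := by
  have : Nonempty {A : Set α // MeasurableSet A} := ⟨⟨∅, .empty⟩⟩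
  exact ciSup_le fun A => h A A.2

lemma tvDist_map_measurableEquiv {β : Type*} [MeasurableSpace β] (φ : α ≃ᵐ β)
    (μ ν : Measure α) : tvDist (μ.map φ) (ν.map φ) = tvDist μ ν := by
  unfold tvDist
  refine Equiv.iSup_congr ⟨fun A => ⟨φ ⁻¹' A, φ.measurable A.2⟩,
    fun A => ⟨φ.symm ⁻¹' A, φ.symm.measurable A.2⟩,
    fun A => by simp [← Set.preimage_comp], fun A => by simp [← Set.preimage_comp]⟩ fun A => ?_
  simp [Measure.real, φ.map_apply]

variable {γ : Measure α} [IsProbabilityMeasure γ] {w : α → ℝ} {ρ : ℝ}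

lemma sq_integral_le_integral_sq (hw : MemLp w 2 γ) :
    (∫ x, w x ∂γ) ^ 2 ≤ ∫ x, w x ^ 2 ∂γ := by
  have := variance_eq_sub hw
  simp only [Pi.pow_apply] at this
  linarith [variance_nonneg w γ]

/-- In `w² - a² = (w - a)(w + a)` the first factor has `L²` norm at most `ρ ‖w‖₂`, and the second
one at most `2 ‖w‖₂`. -/
lemma integral_abs_sq_sub_sq_integral_le (hw : MemLp w 2 γ) (hρ : 0 < ρ)
    (hvar : Var[w; γ] ≤ ρ ^ 2 * ∫ x, w x ^ 2 ∂γ) :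
    ∫ x, |w x ^ 2 - (∫ y, w y ∂γ) ^ 2| ∂γ ≤ 2 * ρ * ∫ x, w x ^ 2 ∂γ := by
  set a := ∫ y, w y ∂γ with ha
  set b := ∫ x, w x ^ 2 ∂γ
  have hdiff : Integrable (fun x => (w x - a) ^ 2) γ := (hw.sub (memLp_const a)).integrable_sq
  have hsum : Integrable (fun x => (w x + a) ^ 2) γ := (hw.add (memLp_const a)).integrable_sq
  have hvar_eq : Var[w; γ] = b - a ^ 2 := by simpa using variance_eq_sub hw
  have hdiff_eq : ∫ x, (w x - a) ^ 2 ∂γ = Var[w; γ] :=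
    (variance_eq_integral hw.aemeasurable).symm
  have hsum_eq : ∫ x, (w x + a) ^ 2 ∂γ = b + 3 * a ^ 2 := by
    have hexpand (x : α) : (w x + a) ^ 2 = (w x - a) ^ 2 + 4 * a * w x := by ring
    simp_rw [hexpand]
    rw [integral_add hdiff ((hw.integrable (by norm_num)).const_mul _), integral_const_mul, ← ha]
    linarith
  have ha_le : a ^ 2 ≤ b := sq_integral_le_integral_sq hw
  have hAMGM (x : α) : |w x ^ 2 - a ^ 2| ≤ ρ⁻¹ * (w x - a) ^ 2 + ρ / 4 * (w x + a) ^ 2 := by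
    rw [show w x ^ 2 - a ^ 2 = (w x - a) * (w x + a) by ring, abs_mul, ← sq_abs (w x - a),
      ← sq_abs (w x + a)]
    have hsq : ρ⁻¹ * |w x - a| ^ 2 + ρ / 4 * |w x + a| ^ 2 - |w x - a| * |w x + a| =
        ρ⁻¹ * (|w x - a| - ρ / 2 * |w x + a|) ^ 2 := by
      field_simp
      ring
    linarith [show 0 ≤ ρ⁻¹ * (|w x - a| - ρ / 2 * |w x + a|) ^ 2 by positivity]
  calc ∫ x, |w x ^ 2 - a ^ 2| ∂γ
      ≤ ∫ x, (ρ⁻¹ * (w x - a) ^ 2 + ρ / 4 * (w x + a) ^ 2) ∂γ :=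
        integral_mono (hw.integrable_sq.sub (integrable_const _)).abs
          ((hdiff.const_mul _).add (hsum.const_mul _)) hAMGM
    _ = ρ⁻¹ * Var[w; γ] + ρ / 4 * (b + 3 * a ^ 2) := by
        rw [integral_add (hdiff.const_mul _) (hsum.const_mul _), integral_const_mul,
          integral_const_mul, hdiff_eq, hsum_eq]
    _ ≤ ρ⁻¹ * (ρ ^ 2 * b) + ρ / 4 * (b + 3 * b) := by gcongr
    _ = 2 * ρ * b := by field_simp; ring

lemma abs_setIntegral_sq_sub_le (hw : MemLp w 2 γ) (hρ : 0 < ρ)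
    (hvar : Var[w; γ] ≤ ρ ^ 2 * ∫ x, w x ^ 2 ∂γ) (A : Set α) :
    |∫ x in A, w x ^ 2 ∂γ - γ.real A * (∫ x, w x ∂γ) ^ 2| ≤ 2 * ρ * ∫ x, w x ^ 2 ∂γ := by
  have hint : Integrable (fun x => w x ^ 2 - (∫ y, w y ∂γ) ^ 2) γ :=
    hw.integrable_sq.sub (integrable_const _)
  have hset : ∫ x in A, w x ^ 2 ∂γ - γ.real A * (∫ x, w x ∂γ) ^ 2 =
      ∫ x in A, (w x ^ 2 - (∫ y, w y ∂γ) ^ 2) ∂γ := by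
    rw [integral_sub hw.integrable_sq.integrableOn (integrable_const _), setIntegral_const,
      smul_eq_mul]
  rw [hset]
  calc |∫ x in A, (w x ^ 2 - (∫ y, w y ∂γ) ^ 2) ∂γ|
      ≤ ∫ x in A, |w x ^ 2 - (∫ y, w y ∂γ) ^ 2| ∂γ := abs_integral_le_integral_abs
    _ ≤ ∫ x, |w x ^ 2 - (∫ y, w y ∂γ) ^ 2| ∂γ :=
        setIntegral_le_integral hint.abs (ae_of_all _ fun _ => abs_nonneg _)
    _ ≤ _ := integral_abs_sq_sub_sq_integral_le hw hρ hvar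

variable {P : Measure α} [IsProbabilityMeasure P] {U : Set α} {c e : ℝ}

lemma mul_integral_sq_le_two (hw : MemLp w 2 γ) (hρ : 0 < ρ) (hρ' : ρ ≤ 1 / 8)
    (hvar : Var[w; γ] ≤ ρ ^ 2 * ∫ x, w x ^ 2 ∂γ) (hU : MeasurableSet U) (hc : 0 ≤ c)
    (hP : P.real U = c * ∫ x in U, w x ^ 2 ∂γ) (hγU : γ.real Uᶜ ≤ 1 / 4) :
    c * ∫ x, w x ^ 2 ∂γ ≤ 2 := by
  set b := ∫ x, w x ^ 2 ∂γ
  have : 0 ≤ b := integral_nonneg fun x => sq_nonneg _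
  have hcompl : ∫ x in Uᶜ, w x ^ 2 ∂γ ≤ b / 2 := by
    have hmass : γ.real Uᶜ * (∫ x, w x ∂γ) ^ 2 ≤ 1 / 4 * b := by
      gcongr
      exact sq_integral_le_integral_sq hw
    have hfluct : 2 * ρ * b ≤ 2 * (1 / 8) * b := by gcongr
    linarith [le_of_abs_le (abs_setIntegral_sq_sub_le hw hρ hvar Uᶜ)]
  have hinside : b / 2 ≤ ∫ x in U, w x ^ 2 ∂γ := by
    linarith [integral_add_compl hU hw.integrable_sq]
  have : c * (b / 2) ≤ 1 := by
    calc c * (b / 2) ≤ c * ∫ x in U, w x ^ 2 ∂γ := by gcongr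
      _ = P.real U := hP.symm
      _ ≤ 1 := measureReal_le_one
  linarith

lemma abs_real_sub_mul_real_le (hw : MemLp w 2 γ) (hρ : 0 < ρ) (hρ' : ρ ≤ 1 / 8)
    (hvar : Var[w; γ] ≤ ρ ^ 2 * ∫ x, w x ^ 2 ∂γ) (hU : MeasurableSet U) (hc : 0 ≤ c)
    (hP : ∀ A ⊆ U, MeasurableSet A → P.real A = c * ∫ x in A, w x ^ 2 ∂γ)
    (he : e ≤ 1 / 4) (hPU : P.real Uᶜ ≤ e) (hγU : γ.real Uᶜ ≤ e) {S : Set α}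
    (hS : MeasurableSet S) :
    |P.real S - c * (∫ x, w x ∂γ) ^ 2 * γ.real S| ≤ 4 * ρ + 2 * e := by
  have hcb : c * ∫ x, w x ^ 2 ∂γ ≤ 2 :=
    mul_integral_sq_le_two hw hρ hρ' hvar hU hc (hP U subset_rfl hU) (hγU.trans he)
  set κ := c * (∫ x, w x ∂γ) ^ 2 with hκ
  have hκ2 : κ ≤ 2 := (mul_le_mul_of_nonneg_left (sq_integral_le_integral_sq hw) hc).trans hcb
  have hinside : |P.real (S ∩ U) - κ * γ.real (S ∩ U)| ≤ 4 * ρ := by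
    rw [hP _ Set.inter_subset_right (hS.inter hU), hκ, mul_assoc, ← mul_sub, abs_mul,
      abs_of_nonneg hc, mul_comm (_ ^ 2)]
    calc c * _ ≤ c * (2 * ρ * ∫ x, w x ^ 2 ∂γ) := by
          gcongr
          exact abs_setIntegral_sq_sub_le hw hρ hvar _
      _ = 2 * ρ * (c * ∫ x, w x ^ 2 ∂γ) := by ring
      _ ≤ 2 * ρ * 2 := by gcongr
      _ = 4 * ρ := by ring
  have houtside : |P.real (S \ U) - κ * γ.real (S \ U)| ≤ 2 * e := by
    have hsub : S \ U ⊆ Uᶜ := fun _ hx => hx.2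
    have hPS : P.real (S \ U) ≤ e := (measureReal_mono hsub).trans hPU
    have hγS : κ * γ.real (S \ U) ≤ 2 * e := by
      gcongr
      exact (measureReal_mono hsub).trans hγU
    have hκ0 : 0 ≤ κ * γ.real (S \ U) := by positivity
    have hP0 : 0 ≤ P.real (S \ U) := measureReal_nonneg
    rw [abs_le]
    constructor <;> linarith
  rw [← measureReal_inter_add_sdiff (μ := P) (s := S) hU,
    ← measureReal_inter_add_sdiff (μ := γ) (s := S) hU]
  calc _ = |(P.real (S ∩ U) - κ * γ.real (S ∩ U)) + (P.real (S \ U) - κ * γ.real (S \ U))| := by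
        ring_nf
    _ ≤ 4 * ρ + 2 * e := (abs_add_le _ _).trans (add_le_add hinside houtside)

/-- Since `Var[w; γ]` is small, `w²` is nearly the constant `a² = (∫ w)²`, and applying the
previous bound to the whole space shows that the normalization `c a²` is nearly one. -/
theorem tvDist_le_of_variance_le (hw : MemLp w 2 γ) (hρ : 0 < ρ) (hρ' : ρ ≤ 1 / 8)
    (hvar : Var[w; γ] ≤ ρ ^ 2 * ∫ x, w x ^ 2 ∂γ) (hU : MeasurableSet U) (hc : 0 ≤ c)
    (hP : ∀ A ⊆ U, MeasurableSet A → P.real A = c * ∫ x in A, w x ^ 2 ∂γ)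
    (he : e ≤ 1 / 4) (hPU : P.real Uᶜ ≤ e) (hγU : γ.real Uᶜ ≤ e) :
    tvDist P γ ≤ 8 * ρ + 4 * e := by
  set κ := c * (∫ x, w x ∂γ) ^ 2
  have hscaled {S : Set α} (hS : MeasurableSet S) :
      |P.real S - κ * γ.real S| ≤ 4 * ρ + 2 * e :=
    abs_real_sub_mul_real_le hw hρ hρ' hvar hU hc hP he hPU hγU hS
  have hκ : |κ - 1| ≤ 4 * ρ + 2 * e := by
    simpa [abs_sub_comm] using hscaled .univ
  refine tvDist_le fun A hA => ?_
  calc |P.real A - γ.real A|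
      = |(P.real A - κ * γ.real A) + (κ - 1) * γ.real A| := by ring_nf
    _ ≤ |P.real A - κ * γ.real A| + |κ - 1| * γ.real A := by
        refine (abs_add_le _ _).trans_eq ?_
        rw [abs_mul, abs_of_nonneg (measureReal_nonneg (μ := γ))]
    _ ≤ (4 * ρ + 2 * e) + (4 * ρ + 2 * e) * 1 := by
        gcongr
        · exact hscaled hA
        · exact (abs_nonneg _).trans hκ
        · exact measureReal_le_one
    _ = 8 * ρ + 4 * e := by ring

end TotalVariation

section ExponentialTail

open Module

variable {E : Type*} [NormedAddCommGroup E] [InnerProductSpace ℝ E] [FiniteDimensional ℝ E]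
  [MeasurableSpace E] [BorelSpace E]

lemma integral_exp_neg_mul_norm {a : ℝ} (ha : 0 < a) :
    ∫ z : E, Real.exp (-(a * ‖z‖)) =
      (finrank ℝ E).factorial * a⁻¹ ^ finrank ℝ E * volume.real (Metric.ball (0 : E) 1) := by
  have hunit : ∫ z : E, Real.exp (-‖z‖) =
      (finrank ℝ E).factorial * volume.real (Metric.ball (0 : E) 1) := by
    have : 0 ≤ ∫ z : E, Real.exp (-‖z‖) := integral_nonneg fun z => (Real.exp_pos _).le
    rw [measureReal_def, measure_unitBall_eq_integral_div_gamma (volume : Measure E) one_pos]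
    simp only [Real.rpow_one, div_one, Real.Gamma_nat_eq_factorial]
    rw [ENNReal.toReal_ofReal (by positivity)]
    field_simp
  have hscale := Measure.integral_comp_smul (volume : Measure E) (fun z => Real.exp (-‖z‖)) a
  simp only [norm_smul, Real.norm_eq_abs, abs_of_pos ha] at hscale
  rw [hscale, hunit, abs_of_pos (by positivity), smul_eq_mul, inv_pow]
  ring

lemma integrable_exp_neg_mul_norm {a : ℝ} (ha : 0 < a) :
    Integrable fun z : E => Real.exp (-(a * ‖z‖)) := by
  by_contra h
  have hball : 0 < volume.real (Metric.ball (0 : E) 1) :=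
    ENNReal.toReal_pos (Metric.measure_ball_pos _ _ one_pos).ne' measure_ball_lt_top.ne
  have hpos := integral_exp_neg_mul_norm (E := E) ha
  rw [integral_undef h] at hpos
  have : 0 < ((finrank ℝ E).factorial : ℝ) := by positivity
  exact absurd hpos (by positivity)

lemma lintegral_exp_neg_mul_norm_le {a : ℝ} (ha : 0 < a) (hda : √(finrank ℝ E) ≤ a) :
    ∫⁻ z : E, ENNReal.ofReal (Real.exp (-(a * ‖z‖))) ≤
      volume (Metric.closedBall (0 : E) (√(finrank ℝ E))) := by
  set d := finrank ℝ E with hd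
  have hsq : √(d : ℝ) * √(d : ℝ) = d := Real.mul_self_sqrt (Nat.cast_nonneg _)
  rw [← ofReal_integral_eq_lintegral_ofReal (integrable_exp_neg_mul_norm ha)
    (ae_of_all _ fun z => (Real.exp_pos _).le), integral_exp_neg_mul_norm ha,
    Measure.addHaar_closedBall _ _ (Real.sqrt_nonneg _),
    ← ENNReal.ofReal_toReal measure_ball_lt_top.ne,
    ← ENNReal.ofReal_mul (by positivity), measureReal_def, ← hd]
  refine ENNReal.ofReal_le_ofReal ?_
  gcongr
  calc (d.factorial : ℝ) * a⁻¹ ^ d ≤ (d : ℝ) ^ d * a⁻¹ ^ d := by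
        gcongr; exact_mod_cast Nat.factorial_le_pow d
    _ = (√(d : ℝ) * (√(d : ℝ) / a)) ^ d := by
        rw [← mul_pow, ← hsq]; congr 1; field_simp; simp
    _ ≤ (√(d : ℝ) * 1) ^ d := by
        gcongr
        exact (div_le_one ha).2 hda
    _ = √(d : ℝ) ^ d := by rw [mul_one]

lemma setLIntegral_compl_closedBall_exp_neg_mul_norm_le {R : ℝ} (hR : 0 < R)
    (hd : 8 * √(finrank ℝ E) ≤ R) :
    ∫⁻ z in (Metric.closedBall (0 : E) R)ᶜ, ENNReal.ofReal (Real.exp (-(R / 4 * ‖z‖))) ≤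
      ENNReal.ofReal (Real.exp (-(R ^ 2 / 8))) *
        volume (Metric.closedBall (0 : E) (√(finrank ℝ E))) := by
  calc ∫⁻ z in (Metric.closedBall (0 : E) R)ᶜ, ENNReal.ofReal (Real.exp (-(R / 4 * ‖z‖)))
      ≤ ∫⁻ z in (Metric.closedBall (0 : E) R)ᶜ, ENNReal.ofReal (Real.exp (-(R ^ 2 / 8))) *
          ENNReal.ofReal (Real.exp (-(R / 8 * ‖z‖))) := by
        refine setLIntegral_mono (by fun_prop) fun z hz => ?_
        rw [← ENNReal.ofReal_mul (Real.exp_pos _).le, ← Real.exp_add]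
        refine ENNReal.ofReal_le_ofReal (Real.exp_le_exp.2 ?_)
        have hz' : R ≤ ‖z‖ := by simpa using (not_le.1 (mt mem_closedBall_zero_iff.2 hz)).le
        nlinarith
    _ ≤ ∫⁻ z : E, ENNReal.ofReal (Real.exp (-(R ^ 2 / 8))) *
          ENNReal.ofReal (Real.exp (-(R / 8 * ‖z‖))) := setLIntegral_le_lintegral _ _
    _ = ENNReal.ofReal (Real.exp (-(R ^ 2 / 8))) *
          ∫⁻ z : E, ENNReal.ofReal (Real.exp (-(R / 8 * ‖z‖))) :=
        lintegral_const_mul _ (by fun_prop)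
    _ ≤ _ := by
        gcongr
        exact lintegral_exp_neg_mul_norm_le (by positivity) (by linarith)

end ExponentialTail

section NearlyQuadratic

variable {E : Type*} [NormedAddCommGroup E] [InnerProductSpace ℝ E]

/-- On the closed ball of radius `R` about the origin, `G` is differentiable and `G - ‖·‖² / 2`
has `τ`-Lipschitz derivative: the sense in which a rescaled negative log likelihood is close to
that of a Gaussian model with identity information. -/
structure NearlyQuadratic (G : E → ℝ) (R : ℝ) (τ : NNReal) : Prop where
  differentiableAt : ∀ z ∈ Metric.closedBall (0 : E) R, DifferentiableAt ℝ G z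
  lipschitzOnWith :
    LipschitzOnWith τ (fun z => fderiv ℝ G z - innerSL ℝ z) (Metric.closedBall 0 R)

lemma hasFDerivAt_half_sq_norm_sub (y z : E) :
    HasFDerivAt (fun x : E => ‖x - y‖ ^ 2 / 2) (innerSL ℝ (z - y)) z := by
  convert! ((hasFDerivAt_id z).sub_const y).norm_sq.const_mul (2 : ℝ)⁻¹ using 1
  · funext x; simp; ring
  · ext v; simp [innerSL_apply_apply ℝ]

namespace NearlyQuadratic

variable {G : E → ℝ} {R : ℝ} {τ : NNReal}

lemma norm_fderiv_sub_le (hG : NearlyQuadratic G R τ) {y z : E}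
    (hy : y ∈ Metric.closedBall (0 : E) R) (hz : z ∈ Metric.closedBall (0 : E) R) :
    ‖fderiv ℝ G z - fderiv ℝ G y - innerSL ℝ (z - y)‖ ≤ τ * ‖z - y‖ := by
  have h := hG.lipschitzOnWith.dist_le_mul z hz y hy
  rw [dist_eq_norm, dist_eq_norm] at h
  rw [map_sub]
  convert! h using 2
  abel

lemma abs_taylor_sub_le (hG : NearlyQuadratic G R τ) {y z : E}
    (hy : y ∈ Metric.closedBall (0 : E) R) (hz : z ∈ Metric.closedBall (0 : E) R) :
    |G z - G y - fderiv ℝ G y (z - y) - ‖z - y‖ ^ 2 / 2| ≤ τ * ‖z - y‖ ^ 2 := by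
  let k : E → ℝ := fun x => G x - fderiv ℝ G y x - ‖x - y‖ ^ 2 / 2
  have hk (x : E) (hx : x ∈ Metric.closedBall (0 : E) R) :
      HasFDerivAt k (fderiv ℝ G x - fderiv ℝ G y - innerSL ℝ (x - y)) x :=
    ((hG.differentiableAt x hx).hasFDerivAt.sub (fderiv ℝ G y).hasFDerivAt).sub
      (hasFDerivAt_half_sq_norm_sub y x)
  let s : Set E := Metric.closedBall 0 R ∩ Metric.closedBall y ‖z - y‖
  have hs : Convex ℝ s := (convex_closedBall _ _).inter (convex_closedBall _ _)
  have hbound (x : E) (hx : x ∈ s) :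
      ‖fderiv ℝ G x - fderiv ℝ G y - innerSL ℝ (x - y)‖ ≤ τ * ‖z - y‖ := by
    refine (hG.norm_fderiv_sub_le hy hx.1).trans ?_
    have := mem_closedBall_iff_norm.1 hx.2
    gcongr
  have hmean := hs.norm_image_sub_le_of_norm_hasFDerivWithin_le
    (fun x hx => (hk x hx.1).hasFDerivWithinAt) hbound (x := y) (y := z)
    ⟨hy, by simp⟩ ⟨hz, by simp [dist_eq_norm]⟩
  calc |G z - G y - fderiv ℝ G y (z - y) - ‖z - y‖ ^ 2 / 2| = ‖k z - k y‖ := by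
        rw [Real.norm_eq_abs]
        simp only [k, sub_self, norm_zero, map_sub]
        ring_nf
    _ ≤ τ * ‖z - y‖ * ‖z - y‖ := hmean
    _ = τ * ‖z - y‖ ^ 2 := by ring

lemma abs_growth_sub_le (hG : NearlyQuadratic G R τ) (hR : 0 ≤ R) {z : E}
    (hz : z ∈ Metric.closedBall (0 : E) R) :
    |G z - G 0 - ‖z‖ ^ 2 / 2| ≤ ‖fderiv ℝ G 0‖ * ‖z‖ + τ * ‖z‖ ^ 2 := by
  have htaylor := hG.abs_taylor_sub_le (Metric.mem_closedBall_self hR) hz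
  simp only [sub_zero] at htaylor
  have hlin : |fderiv ℝ G 0 z| ≤ ‖fderiv ℝ G 0‖ * ‖z‖ := (fderiv ℝ G 0).le_opNorm z
  rw [abs_le] at htaylor hlin ⊢
  constructor <;> linarith [htaylor.1, htaylor.2, hlin.1, hlin.2]

lemma lipschitzOnWith_sub_half_sq_norm_sub (hG : NearlyQuadratic G R τ) {y : E}
    (hy : y ∈ Metric.closedBall (0 : E) R) (hy0 : fderiv ℝ G y = 0) :
    LipschitzOnWith (2 * τ * R.toNNReal) (fun z => G z - ‖z - y‖ ^ 2 / 2)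
      (Metric.closedBall 0 R) := by
  refine (convex_closedBall (0 : E) R).lipschitzOnWith_of_nnnorm_hasFDerivWithin_le
    (fun x hx => ((hG.differentiableAt x hx).hasFDerivAt.sub
      (hasFDerivAt_half_sq_norm_sub y x)).hasFDerivWithinAt) fun x hx => ?_
  have hder := hG.norm_fderiv_sub_le hy hx
  rw [hy0, sub_zero] at hder
  rw [mem_closedBall_zero_iff] at hx hy
  rw [← NNReal.coe_le_coe, coe_nnnorm]
  push_cast
  rw [Real.coe_toNNReal _ ((norm_nonneg x).trans hx)]
  calc ‖fderiv ℝ G x - innerSL ℝ (x - y)‖ ≤ τ * ‖x - y‖ := hder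
    _ ≤ τ * (2 * R) := by gcongr; linarith [_root_.norm_sub_le x y]
    _ = 2 * τ * R := by ring

lemma growth_on_sphere (hG : NearlyQuadratic G R τ) (hτ : τ ≤ 1 / 8)
    (hgrad : 8 * ‖fderiv ℝ G 0‖ ≤ R) {z : E} (hz : ‖z‖ = R) : G 0 + R ^ 2 / 4 ≤ G z := by
  have hR : 0 ≤ R := hz ▸ norm_nonneg z
  have hlower := (abs_le.1 (hG.abs_growth_sub_le hR (mem_closedBall_zero_iff.2 hz.le))).1
  rw [hz] at hlower
  have hlin : ‖fderiv ℝ G 0‖ * R ≤ R / 8 * R := by gcongr; linarith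
  have hτ' : (τ : ℝ) ≤ 1 / 8 := by exact_mod_cast hτ
  have hquad : τ * R ^ 2 ≤ 1 / 8 * R ^ 2 := by gcongr
  linarith

/-- Convexity propagates the quadratic growth on a sphere to linear growth outside. -/
lemma growth_outside (hG : NearlyQuadratic G R τ) (hτ : τ ≤ 1 / 8)
    (hgrad : 8 * ‖fderiv ℝ G 0‖ ≤ R) (hR : 0 < R) {Λ : Set E} (hconv : ConvexOn ℝ Λ G)
    (h0 : 0 ∈ Λ) {z : E} (hzΛ : z ∈ Λ) (hz : R ≤ ‖z‖) :
    G 0 + R / 4 * ‖z‖ ≤ G z := by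
  have hz0 : 0 < ‖z‖ := hR.trans_le hz
  set t := R / ‖z‖ with ht
  have ht0 : 0 < t := by positivity
  have ht1 : t ≤ 1 := (div_le_one hz0).2 hz
  have hnorm : ‖t • z‖ = R := by
    rw [norm_smul, Real.norm_of_nonneg ht0.le, ht]; field_simp
  have hsphere := hG.growth_on_sphere hτ hgrad hnorm
  have hchord := hconv.2 h0 hzΛ (sub_nonneg.2 ht1) ht0.le (sub_add_cancel 1 t)
  simp only [smul_zero, zero_add, smul_eq_mul] at hchord
  have hscale : R ^ 2 / 4 = t * (R / 4 * ‖z‖) := by rw [ht]; field_simp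
  exact le_of_mul_le_mul_left (by linarith : t * (G 0 + R / 4 * ‖z‖) ≤ t * G z) ht0

lemma norm_le_of_le_apply_zero (hG : NearlyQuadratic G R τ) (hτ : τ ≤ 1 / 8) {y : E}
    (hy : y ∈ Metric.closedBall (0 : E) R) (hle : G y ≤ G 0) : ‖y‖ ≤ 3 * ‖fderiv ℝ G 0‖ := by
  have hR : 0 ≤ R := (norm_nonneg y).trans (mem_closedBall_zero_iff.1 hy)
  have hlower := (abs_le.1 (hG.abs_growth_sub_le hR hy)).1
  have hτ' : (τ : ℝ) ≤ 1 / 8 := by exact_mod_cast hτ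
  have hquad : τ * ‖y‖ ^ 2 ≤ 1 / 8 * ‖y‖ ^ 2 := by gcongr
  have hmul : ‖y‖ * (3 / 8 * ‖y‖) ≤ ‖y‖ * ‖fderiv ℝ G 0‖ := by linarith
  rcases (norm_nonneg y).eq_or_lt with h | h
  · rw [← h]; positivity
  · linarith [le_of_mul_le_mul_left hmul h]

lemma lt_of_fderiv_eq_zero (hG : NearlyQuadratic G R τ) (hτ : τ ≤ 1 / 8) {y z : E}
    (hy : y ∈ Metric.closedBall (0 : E) R) (hy0 : fderiv ℝ G y = 0)
    (hz : z ∈ Metric.closedBall (0 : E) R) (hzy : z ≠ y) : G y < G z := by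
  have hlower := (abs_le.1 (hG.abs_taylor_sub_le hy hz)).1
  rw [hy0, zero_apply] at hlower
  have hτ' : (τ : ℝ) ≤ 1 / 8 := by exact_mod_cast hτ
  have hquad : τ * ‖z - y‖ ^ 2 ≤ 1 / 8 * ‖z - y‖ ^ 2 := by gcongr
  have hpos : 0 < ‖z - y‖ ^ 2 := pow_pos (norm_pos_iff.2 (sub_ne_zero.2 hzy)) 2
  linarith

lemma exists_minimizer [FiniteDimensional ℝ E] (hG : NearlyQuadratic G R τ) (hτ : τ ≤ 1 / 8)
    (hgrad : 8 * ‖fderiv ℝ G 0‖ ≤ R) (hR : 0 < R) {Λ : Set E} (hconv : ConvexOn ℝ Λ G)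
    (h0 : 0 ∈ Λ) :
    ∃ y ∈ Metric.closedBall (0 : E) R, ‖y‖ ≤ 3 * ‖fderiv ℝ G 0‖ ∧ fderiv ℝ G y = 0 ∧
      ∀ z ∈ Λ, z ≠ y → G y < G z := by
  have hcont : ContinuousOn G (Metric.closedBall (0 : E) R) := fun z hz =>
    (hG.differentiableAt z hz).continuousAt.continuousWithinAt
  have h0R : (0 : E) ∈ Metric.closedBall 0 R := Metric.mem_closedBall_self hR.le
  obtain ⟨y, hy, hmin⟩ := (isCompact_closedBall (0 : E) R).exists_isMinOn ⟨0, h0R⟩ hcont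
  have hnorm : ‖y‖ ≤ 3 * ‖fderiv ℝ G 0‖ := hG.norm_le_of_le_apply_zero hτ hy (hmin h0R)
  have hlt : ‖y‖ < R := by
    rcases (norm_nonneg (fderiv ℝ G 0)).eq_or_lt with h | h <;> linarith
  have hcrit : fderiv ℝ G y = 0 := (hmin.isLocalMin (Filter.mem_of_superset
    (Metric.isOpen_ball.mem_nhds (mem_ball_zero_iff.2 hlt))
    Metric.ball_subset_closedBall)).fderiv_eq_zero
  refine ⟨y, hy, hnorm, hcrit, fun z hz hzy => ?_⟩
  by_cases hzR : z ∈ Metric.closedBall (0 : E) R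
  · exact hG.lt_of_fderiv_eq_zero hτ hy hcrit hzR hzy
  · have hz' : R < ‖z‖ := not_le.1 (mt mem_closedBall_zero_iff.2 hzR)
    have hgrowth := hG.growth_outside hτ hgrad hR hconv h0 hz hz'.le
    have : 0 < R / 4 * ‖z‖ := by have := hR.trans hz'; positivity
    linarith [show G y ≤ G 0 from hmin h0R]

end NearlyQuadratic

end NearlyQuadratic

section LaplaceApproximation

open Module

variable {E : Type*} [NormedAddCommGroup E]

lemma exists_lipschitzWith_bddAbove_eqOn [ProperSpace E] {f : E → ℝ} {R : ℝ} {L : NNReal}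
    (hf : LipschitzOnWith L f (Metric.closedBall 0 R)) :
    ∃ g : E → ℝ, LipschitzWith L g ∧ BddAbove (Set.range g) ∧
      Set.EqOn f g (Metric.closedBall 0 R) := by
  obtain ⟨g, hg, hfg⟩ := hf.extend_real
  obtain ⟨C, hC⟩ := (isCompact_closedBall (0 : E) R).bddAbove_image hg.continuous.continuousOn
  refine ⟨fun x => min (g x) C, hg.min_const C, ⟨C, ?_⟩, fun x hx => ?_⟩
  · rintro _ ⟨x, rfl⟩
    exact min_le_right _ _
  · rw [hfg hx]
    exact (min_eq_left (hC ⟨x, hx, rfl⟩)).symm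

variable [InnerProductSpace ℝ E] [MeasurableSpace E]

/-- The conditions under which a log-concave `exp (-G)` times a prior `p` is close to a Gaussian
measure: on the ball of radius `R`, `G` is nearly `‖·‖² / 2` and `p` nearly constant; `R` is large
compared to the gradient at the origin and to `√d`, so that little mass lies outside the ball; and
`exp B` bounds the prior on all of `Λ`. -/
structure LaplaceRegime (Λ : Set E) (G p : E → ℝ) (R B : ℝ) (τ η : NNReal) : Prop where
  measurableSet : MeasurableSet Λ
  convexOn : ConvexOn ℝ Λ G
  pos_radius : 0 < R
  closedBall_subset : Metric.closedBall 0 R ⊆ Λ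
  sqrt_finrank_le : 8 * √(finrank ℝ E) ≤ R
  norm_fderiv_le : 8 * ‖fderiv ℝ G 0‖ ≤ R
  nearlyQuadratic : NearlyQuadratic G R τ
  curvature_le : τ ≤ 1 / 8
  pos_prior : ∀ z ∈ Λ, 0 < p z
  lipschitzOnWith_log : LipschitzOnWith η (fun z => Real.log (p z)) (Metric.closedBall 0 R)
  prior_le : ∀ z ∈ Λ, p z ≤ Real.exp B * p 0

variable {Λ : Set E} {G p : E → ℝ} {R B : ℝ} {τ η : NNReal}

namespace LaplaceRegime

lemma zero_mem (h : LaplaceRegime Λ G p R B τ η) : (0 : E) ∈ Λ :=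
  h.closedBall_subset (Metric.mem_closedBall_self h.pos_radius.le)

lemma continuousOn_density (h : LaplaceRegime Λ G p R B τ η) :
    ContinuousOn (fun z => Real.exp (-G z) * p z) (Metric.closedBall 0 R) := by
  have hG : ContinuousOn G (Metric.closedBall 0 R) := fun z hz =>
    (h.nearlyQuadratic.differentiableAt z hz).continuousAt.continuousWithinAt
  have hp : ContinuousOn p (Metric.closedBall 0 R) :=
    h.lipschitzOnWith_log.continuousOn.rexp.congr fun z hz =>
      (Real.exp_log (h.pos_prior z (h.closedBall_subset hz))).symm
  fun_prop

lemma lipschitzOnWith_log_ratio (h : LaplaceRegime Λ G p R B τ η) {y : E}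
    (hy : y ∈ Metric.closedBall 0 R) (hy0 : fderiv ℝ G y = 0) :
    LipschitzOnWith (η + 2 * τ * R.toNNReal)
      (fun z => Real.log (p z) - (G z - ‖z - y‖ ^ 2 / 2)) (Metric.closedBall 0 R) := by
  refine LipschitzOnWith.of_dist_le_mul fun z hz x hx => ?_
  have hprior := h.lipschitzOnWith_log.dist_le_mul z hz x hx
  have hG := (h.nearlyQuadratic.lipschitzOnWith_sub_half_sq_norm_sub hy hy0).dist_le_mul z hz x hx
  rw [NNReal.coe_add, add_mul]
  exact (dist_sub_sub_le _ _ _ _).trans (add_le_add hprior hG)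

lemma exp_neg_mul_le_density (h : LaplaceRegime Λ G p R B τ η) {z : E}
    (hz : z ∈ Metric.closedBall 0 R) :
    Real.exp (-G 0) * p 0 * Real.exp (-(‖fderiv ℝ G 0‖ * ‖z‖ + ‖z‖ ^ 2 + η * ‖z‖)) ≤
      Real.exp (-G z) * p z := by
  have hτ : (τ : ℝ) ≤ 1 / 8 := by exact_mod_cast h.curvature_le
  have hgrowth := le_of_abs_le (h.nearlyQuadratic.abs_growth_sub_le h.pos_radius.le hz)
  have hprior := h.lipschitzOnWith_log.dist_le_mul 0
    (Metric.mem_closedBall_self h.pos_radius.le) z hz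
  rw [Real.dist_eq, dist_zero_left] at hprior
  nth_rewrite 1 [← Real.exp_log (h.pos_prior 0 h.zero_mem)]
  nth_rewrite 1 [← Real.exp_log (h.pos_prior z (h.closedBall_subset hz))]
  rw [← Real.exp_add, ← Real.exp_add, ← Real.exp_add, Real.exp_le_exp]
  nlinarith [le_of_abs_le hprior, sq_nonneg ‖z‖]

lemma density_le_of_le_norm (h : LaplaceRegime Λ G p R B τ η) {z : E} (hzΛ : z ∈ Λ)
    (hz : R ≤ ‖z‖) :
    Real.exp (-G z) * p z ≤
      Real.exp (-G 0) * p 0 * Real.exp B * Real.exp (-(R / 4 * ‖z‖)) := by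
  have hgrowth := h.nearlyQuadratic.growth_outside h.curvature_le h.norm_fderiv_le h.pos_radius
    h.convexOn h.zero_mem hzΛ hz
  calc Real.exp (-G z) * p z
      ≤ Real.exp (-G 0 + -(R / 4 * ‖z‖)) * (Real.exp B * p 0) := by
        have := (h.pos_prior z hzΛ).le
        gcongr
        · linarith
        · exact h.prior_le z hzΛ
    _ = _ := by rw [Real.exp_add]; ring

end LaplaceRegime

variable [FiniteDimensional ℝ E] [BorelSpace E]

lemma stdGaussian_map_const_add_eq_withDensity (y : E) :
    (stdGaussian E).map (y + ·) = volume.withDensity fun x => ENNReal.ofReal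
      ((∫ z : E, Real.exp (-‖z‖ ^ 2 / 2))⁻¹ * Real.exp (-‖x - y‖ ^ 2 / 2)) := by
  ext A hA
  rw [Measure.map_apply (by fun_prop) hA, stdGaussian_eq_withDensity,
    withDensity_apply _ (hA.preimage (by fun_prop)), withDensity_apply _ hA,
    ← (measurePreserving_add_left volume y).setLIntegral_comp_preimage hA (by fun_prop)]
  simp only [add_sub_cancel_left]

lemma stdGaussian_map_const_add_compl_closedBall_le {y : E} {R : ℝ} (hy : ‖y‖ < R) :
    ((stdGaussian E).map (y + ·)).real (Metric.closedBall 0 R)ᶜ ≤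
      finrank ℝ E / (R - ‖y‖) ^ 2 := by
  have hgap : 0 < R - ‖y‖ := sub_pos.2 hy
  have hchebyshev := mul_meas_ge_le_integral_of_nonneg (μ := stdGaussian E)
    (f := fun x => ‖x‖ ^ 2) (ae_of_all _ fun x => by positivity)
    (IsGaussian.memLp_two_id (μ := stdGaussian E)).norm.integrable_sq ((R - ‖y‖) ^ 2)
  have hsub : (y + ·) ⁻¹' (Metric.closedBall (0 : E) R)ᶜ ⊆
      {x : E | (R - ‖y‖) ^ 2 ≤ ‖x‖ ^ 2} := by
    intro x hx
    simp only [Set.mem_preimage, Set.mem_compl_iff, mem_closedBall_zero_iff, not_le] at hx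
    exact pow_le_pow_left₀ hgap.le (by linarith [norm_add_le y x]) 2
  rw [integral_sq_norm_stdGaussian] at hchebyshev
  rw [map_measureReal_apply (by fun_prop) measurableSet_closedBall.compl,
    le_div_iff₀' (by positivity)]
  exact (mul_le_mul_of_nonneg_left (measureReal_mono hsub) (by positivity)).trans hchebyshev

lemma variance_exp_half_stdGaussian_map_const_add_le {f : E → ℝ} {L : NNReal}
    (hf : LipschitzWith L f) (hC : BddAbove (Set.range f)) (y : E) :
    Var[fun x => Real.exp (f x / 2); (stdGaussian E).map (y + ·)] ≤
      L ^ 2 * ∫ x, Real.exp (f x / 2) ^ 2 ∂((stdGaussian E).map (y + ·)) := by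
  obtain ⟨C, hC⟩ := hC
  have hcont := hf.continuous
  have hhalf : LipschitzWith (L / 2) fun x => f (y + x) / 2 := by
    refine LipschitzWith.of_dist_le_mul fun x z => ?_
    have := hf.dist_le_mul (y + x) (y + z)
    rw [dist_add_left, Real.dist_eq] at this
    rw [Real.dist_eq, ← sub_div, abs_div, abs_two, NNReal.coe_div, NNReal.coe_two]
    linarith
  rw [variance_map (by fun_prop) (by fun_prop), integral_map (by fun_prop) (by fun_prop)]
  refine (variance_exp_comp_stdGaussian_le hhalf (C := C / 2) fun x => ?_).trans ?_
  · have := hC ⟨y + x, rfl⟩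
    linarith
  · gcongr
    rw [NNReal.coe_div, NNReal.coe_two]
    have hpi : Real.pi ^ 2 ≤ 4 ^ 2 := by gcongr; exact Real.pi_le_four
    nlinarith [sq_nonneg (L : ℝ)]

lemma measureReal_inv_smul_le {α : Type*} [MeasurableSpace α] {μ : Measure α} [IsFiniteMeasure μ]
    {A : Set α} {e : ℝ} (he : 0 ≤ e) (h : μ A ≤ ENNReal.ofReal e * μ Set.univ) :
    ((μ Set.univ)⁻¹ • μ).real A ≤ e := by
  rw [measureReal_def, Measure.smul_apply, smul_eq_mul]
  refine ENNReal.toReal_le_of_le_ofReal he ?_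
  rw [mul_comm, ← div_eq_mul_inv]
  exact ENNReal.div_le_of_le_mul h

/-- The measure on `Λ` with Lebesgue density `exp (-G) p`: an unnormalized posterior with negative
log likelihood `G` and prior density `p`. -/
noncomputable def gibbsMeasure (Λ : Set E) (G p : E → ℝ) : Measure E :=
  (volume.restrict Λ).withDensity fun z => ENNReal.ofReal (Real.exp (-G z) * p z)

lemma gibbsMeasure_apply {A : Set E} (hA : MeasurableSet A) :
    gibbsMeasure Λ G p A = ∫⁻ z in A ∩ Λ, ENNReal.ofReal (Real.exp (-G z) * p z) := by
  rw [gibbsMeasure, withDensity_apply _ hA, Measure.restrict_restrict hA]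

namespace LaplaceRegime

lemma le_gibbsMeasure_univ (h : LaplaceRegime Λ G p R B τ η) {r : ℝ} (hrR : r ≤ R) :
    ENNReal.ofReal (Real.exp (-G 0) * p 0 *
        Real.exp (-(‖fderiv ℝ G 0‖ * r + r ^ 2 + η * r))) *
      volume (Metric.closedBall (0 : E) r) ≤ gibbsMeasure Λ G p Set.univ := by
  have hp0 := h.pos_prior 0 h.zero_mem
  have hsub : Metric.closedBall (0 : E) r ⊆ Metric.closedBall 0 R :=
    Metric.closedBall_subset_closedBall hrR
  rw [gibbsMeasure_apply .univ, Set.univ_inter, ← setLIntegral_const]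
  refine (setLIntegral_mono' measurableSet_closedBall fun z hz => ?_).trans
    (lintegral_mono_set (hsub.trans h.closedBall_subset))
  refine ENNReal.ofReal_le_ofReal (le_trans ?_ (h.exp_neg_mul_le_density (hsub hz)))
  rw [mem_closedBall_zero_iff] at hz
  gcongr

lemma gibbsMeasure_compl_closedBall_le (h : LaplaceRegime Λ G p R B τ η) :
    gibbsMeasure Λ G p (Metric.closedBall 0 R)ᶜ ≤
      ENNReal.ofReal (Real.exp (-G 0) * p 0 * Real.exp (B - R ^ 2 / 8)) *
        volume (Metric.closedBall (0 : E) (√(finrank ℝ E))) := by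
  set c := Real.exp (-G 0) * p 0 * Real.exp B with hc
  have hc0 : 0 ≤ c := by
    have := (h.pos_prior 0 h.zero_mem).le
    positivity
  calc gibbsMeasure Λ G p (Metric.closedBall 0 R)ᶜ
      ≤ ∫⁻ z in (Metric.closedBall (0 : E) R)ᶜ ∩ Λ,
          ENNReal.ofReal c * ENNReal.ofReal (Real.exp (-(R / 4 * ‖z‖))) := by
        rw [gibbsMeasure_apply measurableSet_closedBall.compl]
        refine setLIntegral_mono' (measurableSet_closedBall.compl.inter h.measurableSet)
          fun z hz => ?_
        rw [← ENNReal.ofReal_mul hc0]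
        have hzR : R < ‖z‖ := by simpa using hz.1
        exact ENNReal.ofReal_le_ofReal (h.density_le_of_le_norm hz.2 hzR.le)
    _ ≤ ENNReal.ofReal c * ∫⁻ z in (Metric.closedBall (0 : E) R)ᶜ,
          ENNReal.ofReal (Real.exp (-(R / 4 * ‖z‖))) :=
        (lintegral_mono_set Set.inter_subset_left).trans_eq
          (lintegral_const_mul _ (by fun_prop))
    _ ≤ ENNReal.ofReal c * (ENNReal.ofReal (Real.exp (-(R ^ 2 / 8))) *
          volume (Metric.closedBall (0 : E) (√(finrank ℝ E)))) := by
        gcongr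
        exact setLIntegral_compl_closedBall_exp_neg_mul_norm_le h.pos_radius h.sqrt_finrank_le
    _ = _ := by
        rw [← mul_assoc, ← ENNReal.ofReal_mul hc0, hc, mul_assoc _ (Real.exp B), ← Real.exp_add,
          sub_eq_add_neg]

lemma gibbsMeasure_compl_closedBall_le_mul_univ (h : LaplaceRegime Λ G p R B τ η) {e : ℝ}
    (he : 0 < e)
    (hexp : B + ‖fderiv ℝ G 0‖ * √(finrank ℝ E) + finrank ℝ E + η * √(finrank ℝ E) - Real.log e ≤
      R ^ 2 / 8) :
    gibbsMeasure Λ G p (Metric.closedBall 0 R)ᶜ ≤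
      ENNReal.ofReal e * gibbsMeasure Λ G p Set.univ := by
  have hp0 := h.pos_prior 0 h.zero_mem
  have hd : √(finrank ℝ E : ℝ) ≤ R := by
    linarith [h.sqrt_finrank_le, Real.sqrt_nonneg (finrank ℝ E : ℝ)]
  refine h.gibbsMeasure_compl_closedBall_le.trans
    (le_trans ?_ (mul_le_mul_right (h.le_gibbsMeasure_univ hd) _))
  rw [← mul_assoc, ← ENNReal.ofReal_mul he.le, Real.sq_sqrt (Nat.cast_nonneg _)]
  gcongr ENNReal.ofReal ?_ * _
  nth_rewrite 1 [← Real.exp_log he]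
  rw [mul_left_comm, ← Real.exp_add]
  gcongr _ * Real.exp ?_
  linarith

lemma neZero_gibbsMeasure (h : LaplaceRegime Λ G p R B τ η) : NeZero (gibbsMeasure Λ G p) := by
  refine ⟨fun h0 => ?_⟩
  have hp0 := h.pos_prior 0 h.zero_mem
  have hle := h.le_gibbsMeasure_univ le_rfl
  rw [h0, Measure.coe_zero, Pi.zero_apply, nonpos_iff_eq_zero, mul_eq_zero,
    ENNReal.ofReal_eq_zero] at hle
  exact hle.elim (not_le.2 (by positivity)) (Metric.measure_closedBall_pos _ _ h.pos_radius).ne'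

lemma isFiniteMeasure_gibbsMeasure (h : LaplaceRegime Λ G p R B τ η) :
    IsFiniteMeasure (gibbsMeasure Λ G p) := by
  have hball : gibbsMeasure Λ G p (Metric.closedBall 0 R) < ∞ := by
    rw [gibbsMeasure_apply measurableSet_closedBall, Set.inter_eq_left.2 h.closedBall_subset]
    exact (h.continuousOn_density.integrableOn_compact (isCompact_closedBall _ _)).lintegral_lt_top
  have hcompl : gibbsMeasure Λ G p (Metric.closedBall 0 R)ᶜ < ∞ :=
    h.gibbsMeasure_compl_closedBall_le.trans_lt
      (ENNReal.mul_lt_top ENNReal.ofReal_lt_top measure_closedBall_lt_top)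
  refine ⟨?_⟩
  rw [← measure_add_measure_compl (s := Metric.closedBall (0 : E) R) measurableSet_closedBall]
  exact ENNReal.add_lt_top.2 ⟨hball, hcompl⟩

lemma real_gibbsMeasure_eq (h : LaplaceRegime Λ G p R B τ η) {y : E} {g : E → ℝ}
    (hg : Continuous g)
    (hfg : Set.EqOn (fun z => Real.log (p z) - (G z - ‖z - y‖ ^ 2 / 2)) g
      (Metric.closedBall 0 R)) {A : Set E} (hAR : A ⊆ Metric.closedBall 0 R)
    (hA : MeasurableSet A) :
    (gibbsMeasure Λ G p).real A = (∫ z : E, Real.exp (-‖z‖ ^ 2 / 2)) *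
      ∫ x in A, Real.exp (g x / 2) ^ 2 ∂((stdGaussian E).map (y + ·)) := by
  set κ := ∫ z : E, Real.exp (-‖z‖ ^ 2 / 2) with hκ
  have hκ0 : 0 < κ := integral_exp_pos integrable_exp_neg_half_sq_norm
  have hdensity {z : E} (hz : z ∈ A) :
      Real.exp (-G z) * p z = Real.exp (-‖z - y‖ ^ 2 / 2) * Real.exp (g z / 2) ^ 2 := by
    rw [← hfg (hAR hz), ← Real.exp_nat_mul, ← Real.exp_add]
    nth_rewrite 1 [← Real.exp_log (h.pos_prior z (h.closedBall_subset (hAR hz)))]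
    rw [← Real.exp_add]
    congr 1
    push_cast
    ring
  have hgauss (x : E) :
      κ * ((ENNReal.ofReal (κ⁻¹ * Real.exp (-‖x - y‖ ^ 2 / 2))).toReal • Real.exp (g x / 2) ^ 2) =
        Real.exp (-‖x - y‖ ^ 2 / 2) * Real.exp (g x / 2) ^ 2 := by
    rw [ENNReal.toReal_ofReal (by positivity), smul_eq_mul]
    field_simp
  rw [stdGaussian_map_const_add_eq_withDensity,
    setIntegral_withDensity_eq_setIntegral_toReal_smul (by fun_prop) (by simp) _ hA,
    ← integral_const_mul, ← hκ]
  simp_rw [hgauss]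
  rw [integral_eq_lintegral_of_nonneg_ae (ae_of_all _ fun x => by positivity) (by fun_prop),
    measureReal_def, gibbsMeasure_apply hA, Set.inter_eq_left.2 (hAR.trans h.closedBall_subset)]
  congr 1
  exact setLIntegral_congr_fun hA fun z hz => by simp only [hdensity hz]

lemma stdGaussian_map_const_add_compl_le (h : LaplaceRegime Λ G p R B τ η) {y : E}
    (hy : ‖y‖ ≤ 3 * ‖fderiv ℝ G 0‖) {e : ℝ} (he : 4 * finrank ℝ E ≤ e * R ^ 2) :
    ((stdGaussian E).map (y + ·)).real (Metric.closedBall 0 R)ᶜ ≤ e := by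
  have hR := h.pos_radius
  have hgap : R / 2 ≤ R - ‖y‖ := by linarith [h.norm_fderiv_le]
  calc ((stdGaussian E).map (y + ·)).real (Metric.closedBall 0 R)ᶜ
      ≤ finrank ℝ E / (R - ‖y‖) ^ 2 :=
        stdGaussian_map_const_add_compl_closedBall_le (by linarith)
    _ ≤ finrank ℝ E / (R / 2) ^ 2 := by gcongr
    _ ≤ e := by
        rw [div_le_iff₀ (by positivity)]
        linarith

variable {e ρ : ℝ}

lemma tvDist_gibbsMeasure_le (h : LaplaceRegime Λ G p R B τ η) {y : E}
    (hyR : y ∈ Metric.closedBall 0 R) (hy : ‖y‖ ≤ 3 * ‖fderiv ℝ G 0‖) (hy0 : fderiv ℝ G y = 0)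
    (he : 0 < e) (he' : e ≤ 1 / 4) (hed : 4 * finrank ℝ E ≤ e * R ^ 2)
    (hexp : B + ‖fderiv ℝ G 0‖ * √(finrank ℝ E) + finrank ℝ E + η * √(finrank ℝ E) - Real.log e ≤
      R ^ 2 / 8)
    (hρ : 0 < ρ) (hρ' : ρ ≤ 1 / 8) (hηρ : η + 2 * τ * R ≤ ρ) :
    tvDist ((gibbsMeasure Λ G p Set.univ)⁻¹ • gibbsMeasure Λ G p)
      ((stdGaussian E).map (y + ·)) ≤ 8 * ρ + 4 * e := by
  have : NeZero (gibbsMeasure Λ G p) := h.neZero_gibbsMeasure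
  have : IsFiniteMeasure (gibbsMeasure Λ G p) := h.isFiniteMeasure_gibbsMeasure
  have : IsProbabilityMeasure ((stdGaussian E).map (y + ·)) :=
    Measure.isProbabilityMeasure_map (by fun_prop)
  obtain ⟨g, hg, hgC, hfg⟩ :=
    exists_lipschitzWith_bddAbove_eqOn (h.lipschitzOnWith_log_ratio hyR hy0)
  have hρL : ((η + 2 * τ * R.toNNReal : NNReal) : ℝ) ≤ ρ := by
    simpa [Real.coe_toNNReal _ h.pos_radius.le] using hηρ
  have hvar := variance_exp_half_stdGaussian_map_const_add_le hg hgC y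
  have hcompl := h.gibbsMeasure_compl_closedBall_le_mul_univ he hexp
  refine tvDist_le_of_variance_le (U := Metric.closedBall 0 R) (w := fun z => Real.exp (g z / 2))
    (c := ((gibbsMeasure Λ G p).real Set.univ)⁻¹ * ∫ z : E, Real.exp (-‖z‖ ^ 2 / 2))
    ?_ hρ hρ' (hvar.trans ?_) measurableSet_closedBall (by positivity) (fun A hAR hA => ?_) he'
    (measureReal_inv_smul_le he.le hcompl) (h.stdGaussian_map_const_add_compl_le hy hed)
  · have hcont := hg.continuous
    obtain ⟨C, hC⟩ := hgC
    refine MemLp.of_bound (by fun_prop) (Real.exp (C / 2)) (ae_of_all _ fun x => ?_)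
    rw [Real.norm_eq_abs, Real.abs_exp]
    gcongr
    exact hC ⟨x, rfl⟩
  · gcongr
  · rw [measureReal_ennreal_smul_apply, ENNReal.toReal_inv,
      h.real_gibbsMeasure_eq hg.continuous hfg hAR hA, mul_assoc, measureReal_def]

theorem exists_tvDist_gibbsMeasure_le (h : LaplaceRegime Λ G p R B τ η)
    (he : 0 < e) (he' : e ≤ 1 / 4) (hed : 4 * finrank ℝ E ≤ e * R ^ 2)
    (hexp : B + ‖fderiv ℝ G 0‖ * √(finrank ℝ E) + finrank ℝ E + η * √(finrank ℝ E) - Real.log e ≤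
      R ^ 2 / 8)
    (hρ : 0 < ρ) (hρ' : ρ ≤ 1 / 8) (hηρ : η + 2 * τ * R ≤ ρ) :
    ∃ y ∈ Λ, (∀ z ∈ Λ, z ≠ y → G y < G z) ∧
      tvDist ((gibbsMeasure Λ G p Set.univ)⁻¹ • gibbsMeasure Λ G p)
        ((stdGaussian E).map (y + ·)) ≤ 8 * ρ + 4 * e := by
  obtain ⟨y, hyR, hy, hy0, hmin⟩ := h.nearlyQuadratic.exists_minimizer h.curvature_le
    h.norm_fderiv_le h.pos_radius h.convexOn h.zero_mem
  exact ⟨y, h.closedBall_subset hyR, hmin,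
    h.tvDist_gibbsMeasure_le hyR hy hy0 he he' hed hexp hρ hρ' hηρ⟩

end LaplaceRegime

end LaplaceApproximation

section LaplaceTransform

universe u

variable {E : Type u} [NormedAddCommGroup E] [InnerProductSpace ℝ E]

lemma exists_finset_norm_le_two_mul_inner [FiniteDimensional ℝ E] :
    ∃ t : Finset E, (∀ u ∈ t, ‖u‖ ≤ 1) ∧ ∀ y, ∃ u ∈ t, ‖y‖ ≤ 2 * inner ℝ u y := by
  obtain ⟨t, ht, htfin, hcover⟩ := (isCompact_closedBall (0 : E) 1).finite_cover_balls
    (one_half_pos (α := ℝ))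
  lift t to Finset E using htfin
  refine ⟨t, fun u hu => by simpa using ht hu, fun y => ?_⟩
  have hz : ‖y‖⁻¹ • y ∈ Metric.closedBall (0 : E) 1 := by
    rw [mem_closedBall_zero_iff, norm_smul, norm_inv, norm_norm]
    exact inv_mul_le_one
  obtain ⟨u, hu, huy⟩ := Set.mem_iUnion₂.1 (hcover hz)
  refine ⟨u, hu, ?_⟩
  have hinner : inner ℝ (‖y‖⁻¹ • y) y = ‖y‖ := by
    rw [real_inner_smul_left, real_inner_self_eq_norm_mul_norm, ← mul_assoc,
      inv_mul_mul_self]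
  have hdist : inner ℝ (‖y‖⁻¹ • y - u) y ≤ 1 / 2 * ‖y‖ :=
    (real_inner_le_norm _ _).trans (by gcongr; exact (mem_ball_iff_norm.1 huy).le)
  rw [inner_sub_left, hinner] at hdist
  linarith

/-- Growth slower than every exponential of the norm. Differentiating
`∫ exp ⟪ω, y⟫ • g y ∂μ(y)` in `ω` multiplies `g` by a linear function of `y`, so that the class
of admissible `g` has to be stable under this operation. -/
def SubexponentialGrowth {F : Type*} [NormedAddCommGroup F] (g : E → F) : Prop :=
  ∀ a > 0, ∃ A : ℝ, ∀ y, ‖g y‖ ≤ A * Real.exp (a * ‖y‖)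

omit [InnerProductSpace ℝ E] in
lemma subexponentialGrowth_const {F : Type*} [NormedAddCommGroup F] (c : F) :
    SubexponentialGrowth fun _ : E => c := fun a ha =>
  ⟨‖c‖, fun y => le_mul_of_one_le_right (norm_nonneg c) (Real.one_le_exp (by positivity))⟩

variable {F : Type u} [NormedAddCommGroup F] [NormedSpace ℝ F] {g : E → F}

lemma SubexponentialGrowth.smulRight (hg : SubexponentialGrowth g) :
    SubexponentialGrowth fun y => (innerSL ℝ y).smulRight (g y) := by
  intro a ha
  obtain ⟨A, hgA⟩ := hg (a / 2) (by positivity)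
  refine ⟨2 / a * A, fun y => ?_⟩
  have hy : ‖y‖ ≤ 2 / a * Real.exp (a / 2 * ‖y‖) := by
    have := Real.add_one_le_exp (a / 2 * ‖y‖)
    rw [div_mul_eq_mul_div, le_div_iff₀ ha]
    linarith
  calc ‖(innerSL ℝ y).smulRight (g y)‖ = ‖y‖ * ‖g y‖ := by
        rw [ContinuousLinearMap.norm_smulRight_apply, innerSL_apply_norm]
    _ ≤ 2 / a * Real.exp (a / 2 * ‖y‖) * (A * Real.exp (a / 2 * ‖y‖)) := by
        gcongr; exact hgA y
    _ = 2 / a * A * Real.exp (a / 2 * ‖y‖ + a / 2 * ‖y‖) := by rw [Real.exp_add]; ring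
    _ = 2 / a * A * Real.exp (a * ‖y‖) := by ring_nf

variable [MeasurableSpace E] [BorelSpace E] [FiniteDimensional ℝ E] {μ : Measure E} {ω : E}

lemma exists_integrable_exp_inner_add_norm
    (h : ∀ᶠ ω' in 𝓝 ω, Integrable (fun y => Real.exp (inner ℝ ω' y)) μ) :
    ∃ a > 0, Integrable (fun y => Real.exp (inner ℝ ω y + a * ‖y‖)) μ := by
  obtain ⟨ε, hε, hball⟩ := Metric.eventually_nhds_iff_ball.1 h
  obtain ⟨t, ht, hcover⟩ := exists_finset_norm_le_two_mul_inner (E := E)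
  have hint : ∀ u ∈ t, Integrable (fun y => Real.exp (inner ℝ (ω + (2 * (ε / 3)) • u) y)) μ := by
    intro u hu
    refine hball _ (mem_ball_iff_norm.2 ?_)
    rw [add_sub_cancel_left, norm_smul, Real.norm_of_nonneg (by positivity)]
    nlinarith [ht u hu]
  refine ⟨ε / 3, by positivity, (integrable_finsetSum t hint).mono'
    (Continuous.aestronglyMeasurable (by fun_prop)) (ae_of_all _ fun y => ?_)⟩
  obtain ⟨u, hu, huy⟩ := hcover y
  have hle : inner ℝ ω y + ε / 3 * ‖y‖ ≤ inner ℝ (ω + (2 * (ε / 3)) • u) y := by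
    rw [inner_add_left, real_inner_smul_left]
    nlinarith
  rw [Real.norm_of_nonneg (Real.exp_pos _).le]
  exact (Real.exp_le_exp.2 hle).trans (Finset.single_le_sum
    (f := fun u => Real.exp (inner ℝ (ω + (2 * (ε / 3)) • u) y))
    (fun _ _ => (Real.exp_pos _).le) hu)

omit [MeasurableSpace E] [BorelSpace E] [FiniteDimensional ℝ E] in
lemma hasFDerivAt_exp_inner_smul (ω y : E) (c : F) :
    HasFDerivAt (fun ω : E => Real.exp (inner ℝ ω y) • c)
      (Real.exp (inner ℝ ω y) • (innerSL ℝ y).smulRight c) ω := by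
  have hinner : HasFDerivAt (fun ω : E => inner ℝ ω y) (innerSL ℝ y) ω := by
    simpa only [coe_innerSL_apply, real_inner_comm] using (innerSL ℝ y).hasFDerivAt (x := ω)
  convert! hinner.exp.smul_const c using 1
  ext v
  simp [smul_smul]

lemma integrable_exp_inner_smul {a : ℝ} (ha : 0 < a)
    (hint : Integrable (fun y => Real.exp (inner ℝ ω y + a * ‖y‖)) μ)
    (hgc : Continuous g) (hg : SubexponentialGrowth g) :
    Integrable (fun y => Real.exp (inner ℝ ω y) • g y) μ := by
  obtain ⟨A, hgA⟩ := hg a ha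
  refine (hint.const_mul A).mono' (Continuous.aestronglyMeasurable (by fun_prop))
    (ae_of_all _ fun y => ?_)
  rw [norm_smul, Real.norm_of_nonneg (Real.exp_pos _).le, Real.exp_add, mul_left_comm]
  gcongr
  exact hgA y

lemma hasFDerivAt_integral_exp_inner_smul
    (h : ∀ᶠ ω' in 𝓝 ω, Integrable (fun y => Real.exp (inner ℝ ω' y)) μ)
    (hgc : Continuous g) (hg : SubexponentialGrowth g) :
    HasFDerivAt (fun ω => ∫ y, Real.exp (inner ℝ ω y) • g y ∂μ)
      (∫ y, Real.exp (inner ℝ ω y) • (innerSL ℝ y).smulRight (g y) ∂μ) ω := by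
  obtain ⟨a, ha, hint⟩ := exists_integrable_exp_inner_add_norm h
  obtain ⟨A, hgA⟩ := hg.smulRight (a / 2) (by positivity)
  have := secondCountableTopologyEither_of_left E (E →L[ℝ] F)
  refine hasFDerivAt_integral_of_dominated_of_fderiv_le
    (bound := fun y => A * Real.exp (inner ℝ ω y + a * ‖y‖))
    (Metric.ball_mem_nhds ω (half_pos ha))
    (Eventually.of_forall fun ω' => Continuous.aestronglyMeasurable (by fun_prop))
    (integrable_exp_inner_smul ha hint hgc hg) (Continuous.aestronglyMeasurable (by fun_prop))
    (ae_of_all _ fun y ω' hω' => ?_) (hint.const_mul A)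
    (ae_of_all _ fun y ω' _ => hasFDerivAt_exp_inner_smul ω' y (g y))
  have hle : inner ℝ ω' y ≤ inner ℝ ω y + a / 2 * ‖y‖ := by
    have : inner ℝ (ω' - ω) y ≤ a / 2 * ‖y‖ :=
      (real_inner_le_norm _ _).trans (by gcongr; exact (mem_ball_iff_norm.1 hω').le)
    rw [inner_sub_left] at this
    linarith
  rw [norm_smul, Real.norm_of_nonneg (Real.exp_pos _).le]
  calc Real.exp (inner ℝ ω' y) * ‖(innerSL ℝ y).smulRight (g y)‖
      ≤ Real.exp (inner ℝ ω y + a / 2 * ‖y‖) * (A * Real.exp (a / 2 * ‖y‖)) := by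
        gcongr; exact hgA y
    _ = A * Real.exp (inner ℝ ω y + a / 2 * ‖y‖ + a / 2 * ‖y‖) := by
        rw [mul_left_comm, ← Real.exp_add]
    _ = A * Real.exp (inner ℝ ω y + a * ‖y‖) := by rw [add_assoc, ← add_mul, add_halves]

lemma contDiffAt_integral_exp_inner_smul (n : ℕ) {F : Type u} [NormedAddCommGroup F]
    [NormedSpace ℝ F] {g : E → F} {ω : E}
    (h : ∀ᶠ ω' in 𝓝 ω, Integrable (fun y => Real.exp (inner ℝ ω' y)) μ)
    (hgc : Continuous g) (hg : SubexponentialGrowth g) :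
    ContDiffAt ℝ n (fun ω => ∫ y, Real.exp (inner ℝ ω y) • g y ∂μ) ω := by
  induction n generalizing F with
  | zero =>
    refine contDiffAt_zero.2 ⟨_, eventually_eventually_nhds.2 h, fun ω' hω' => ?_⟩
    exact (hasFDerivAt_integral_exp_inner_smul hω' hgc hg).continuousAt.continuousWithinAt
  | succ n ih =>
    refine contDiffAt_succ_iff_hasFDerivAt.2 ⟨_, ⟨_, eventually_eventually_nhds.2 h,
      fun ω' hω' => hasFDerivAt_integral_exp_inner_smul hω' hgc hg⟩, ih (by fun_prop) hg.smulRight⟩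

end LaplaceTransform

section AffineComposition

variable {E F : Type*} [NormedAddCommGroup E] [NormedSpace ℝ E] [NormedAddCommGroup F]
  [NormedSpace ℝ F] {f : F → ℝ} {n : ℕ} {ω : F}

lemma iteratedFDeriv_comp_add_clm (L : E →L[ℝ] F) {z : E} (hf : ContDiffAt ℝ n f (ω + L z))
    (m : Fin n → E) :
    iteratedFDeriv ℝ n (fun z => f (ω + L z)) z m =
      iteratedFDeriv ℝ n f (ω + L z) fun i => L (m i) := by
  obtain ⟨s, hs, hso, hzs⟩ := eventually_nhds_iff.1 (hf.eventually (by simp))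
  set s' : Set F := (fun y => ω + y) ⁻¹' s
  have hs' : IsOpen s' := hso.preimage (by fun_prop)
  have hLs' : IsOpen (L ⁻¹' s') := hs'.preimage L.continuous
  have hf' : ContDiffOn ℝ n (fun y => f (ω + y)) s' := fun y hy =>
    ((hs _ hy).comp y (contDiff_const.add contDiff_id).contDiffAt).contDiffWithinAt
  have h := L.iteratedFDerivWithin_comp_right hf' hs'.uniqueDiffOn hLs'.uniqueDiffOn hzs le_rfl
  rw [iteratedFDerivWithin_of_isOpen n hLs' hzs, iteratedFDerivWithin_of_isOpen n hs' hzs,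
    iteratedFDeriv_comp_add_left] at h
  exact congrArg (fun T => T m) h

lemma iteratedDeriv_comp_add_smul (hf : ContDiffAt ℝ n f ω) (v : F) :
    iteratedDeriv n (fun t : ℝ => f (ω + t • v)) 0 = iteratedFDeriv ℝ n f ω fun _ => v := by
  have h := iteratedFDeriv_comp_add_clm (ContinuousLinearMap.toSpanSingleton ℝ v) (z := 0)
    (ω := ω) (f := f) (n := n) (by simpa using hf) (fun _ => 1)
  simpa [iteratedDeriv_eq_iteratedFDeriv] using h

end AffineComposition

namespace ExpFam

variable {k : ℕ} {μ : Measure (EuclideanSpace ℝ (Fin k))} {ω : EuclideanSpace ℝ (Fin k)}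

lemma integral_exp_inner_pos (hμ : μ ≠ 0) (hω : ω ∈ Omega μ) :
    0 < ∫ y, Real.exp (inner ℝ ω y) ∂μ := by
  have : NeZero μ := ⟨hμ⟩
  exact integral_exp_pos hω

lemma exp_psi (hμ : μ ≠ 0) (hω : ω ∈ Omega μ) :
    Real.exp (psi μ ω) = ∫ y, Real.exp (inner ℝ ω y) ∂μ :=
  Real.exp_log (integral_exp_inner_pos hμ hω)

lemma contDiffAt_psi (hμ : μ ≠ 0) (hreg : IsRegular μ) (n : ℕ) (hω : ω ∈ Omega μ) :
    ContDiffAt ℝ n (psi μ) ω := by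
  have h := contDiffAt_integral_exp_inner_smul n (hreg.mem_nhds hω) continuous_const
    (subexponentialGrowth_const (1 : ℝ))
  simp only [smul_eq_mul, mul_one] at h
  exact h.log (integral_exp_inner_pos hμ hω).ne'

lemma convex_Omega : Convex ℝ (Omega μ) := by
  intro x hx y hy a b ha hb hab
  refine Integrable.mono' ((Integrable.const_mul hx a).add (Integrable.const_mul hy b))
    (Continuous.aestronglyMeasurable (by fun_prop)) (ae_of_all _ fun z => ?_)
  rw [Real.norm_of_nonneg (Real.exp_pos _).le, inner_add_left, real_inner_smul_left,
    real_inner_smul_left]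
  exact convexOn_exp.2 (Set.mem_univ _) (Set.mem_univ _) ha hb hab

lemma density_eq_exp_div (hμ : μ ≠ 0) (hω : ω ∈ Omega μ) (y : EuclideanSpace ℝ (Fin k)) :
    density μ ω y = Real.exp (inner ℝ ω y) / ∫ y, Real.exp (inner ℝ ω y) ∂μ := by
  rw [density, Real.exp_sub, exp_psi hμ hω]

lemma withDensity_density (hμ : μ ≠ 0) (hω : ω ∈ Omega μ) :
    μ.withDensity (fun y => ENNReal.ofReal (density μ ω y)) = μ.tilted (inner ℝ ω) := by
  simp only [density_eq_exp_div hμ hω, Measure.tilted]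

lemma integrable_density (hμ : μ ≠ 0) (hω : ω ∈ Omega μ) : Integrable (density μ ω) μ := by
  simpa only [funext (density_eq_exp_div hμ hω)] using Integrable.div_const hω _

lemma integral_density (hμ : μ ≠ 0) (hω : ω ∈ Omega μ) : ∫ y, density μ ω y ∂μ = 1 := by
  simp only [density_eq_exp_div hμ hω, integral_div]
  exact div_self (integral_exp_inner_pos hμ hω).ne'

/-- By convexity of `exp`, `exp ⟪ax + by, ·⟫` divided by `exp (a ψ(x) + b ψ(y))` is dominated by
the convex combination of two probability densities. -/
lemma convexOn_psi (hμ : μ ≠ 0) : ConvexOn ℝ (Omega μ) (psi μ) := by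
  refine ⟨convex_Omega, fun x hx y hy a b ha hb hab => ?_⟩
  have hmem := convex_Omega hx hy ha hb hab
  set c := a • psi μ x + b • psi μ y
  have hle : ∀ z, Real.exp (inner ℝ (a • x + b • y) z) / Real.exp c ≤
      a * density μ x z + b * density μ y z := fun z => by
    rw [← Real.exp_sub, inner_add_left, real_inner_smul_left, real_inner_smul_left]
    convert! convexOn_exp.2 (Set.mem_univ (inner ℝ x z - psi μ x))
      (Set.mem_univ (inner ℝ y z - psi μ y)) ha hb hab using 2
    simp only [c, smul_eq_mul]
    ring
  have hx' := (integrable_density hμ hx).const_mul a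
  have hy' := (integrable_density hμ hy).const_mul b
  have hint := integral_mono (Integrable.div_const hmem (Real.exp c)) (hx'.add hy') hle
  rw [integral_div, integral_add' hx' hy', integral_const_mul, integral_const_mul,
    integral_density hμ hx, integral_density hμ hy, mul_one, mul_one, hab, ← exp_psi hμ hmem,
    div_le_one (Real.exp_pos c)] at hint
  exact Real.exp_le_exp.1 hint

lemma isProbabilityMeasure_tilted_inner (hμ : μ ≠ 0) (hω : ω ∈ Omega μ) :
    IsProbabilityMeasure (μ.tilted (inner ℝ ω)) := by
  have : NeZero μ := ⟨hμ⟩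
  exact isProbabilityMeasure_tilted hω

lemma mgf_inner_tilted (ω v : EuclideanSpace ℝ (Fin k)) (t : ℝ) :
    mgf (inner ℝ v) (μ.tilted (inner ℝ ω)) t =
      (∫ y, Real.exp (inner ℝ (ω + t • v) y) ∂μ) / ∫ y, Real.exp (inner ℝ ω y) ∂μ := by
  simp only [mgf, integral_exp_tilted, Pi.add_apply, inner_add_left, real_inner_smul_left]

lemma eventually_add_smul_mem_Omega (hreg : IsRegular μ) (hω : ω ∈ Omega μ)
    (v : EuclideanSpace ℝ (Fin k)) : ∀ᶠ t : ℝ in 𝓝 0, ω + t • v ∈ Omega μ := by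
  have hline : Continuous fun t : ℝ => ω + t • v := by fun_prop
  exact hline.continuousAt.eventually_mem (hreg.mem_nhds (by simpa using hω))

lemma zero_mem_interior_integrableExpSet_inner (hreg : IsRegular μ) (hω : ω ∈ Omega μ)
    (v : EuclideanSpace ℝ (Fin k)) :
    (0 : ℝ) ∈ interior (integrableExpSet (inner ℝ v) (μ.tilted (inner ℝ ω))) := by
  rw [mem_interior_iff_mem_nhds]
  filter_upwards [eventually_add_smul_mem_Omega hreg hω v] with t ht
  refine (integrable_tilted_iff hω _).2 (Integrable.congr ht (ae_of_all _ fun y => ?_))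
  simp only [inner_add_left, real_inner_smul_left, Real.exp_add, smul_eq_mul]

lemma cgf_inner_tilted_eventuallyEq (hμ : μ ≠ 0) (hreg : IsRegular μ) (hω : ω ∈ Omega μ)
    (v : EuclideanSpace ℝ (Fin k)) :
    cgf (inner ℝ v) (μ.tilted (inner ℝ ω)) =ᶠ[𝓝 0]
      fun t => psi μ (ω + t • v) - psi μ ω := by
  filter_upwards [eventually_add_smul_mem_Omega hreg hω v] with t ht
  rw [cgf, mgf_inner_tilted, Real.log_div (integral_exp_inner_pos hμ ht).ne'
    (integral_exp_inner_pos hμ hω).ne', psi, psi]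

lemma memLp_inner_tilted (hreg : IsRegular μ) (hω : ω ∈ Omega μ)
    (v : EuclideanSpace ℝ (Fin k)) : MemLp (inner ℝ v) 2 (μ.tilted (inner ℝ ω)) :=
  memLp_of_mem_interior_integrableExpSet (zero_mem_interior_integrableExpSet_inner hreg hω v) 2

lemma integral_inner_tilted (hμ : μ ≠ 0) (hreg : IsRegular μ) (hω : ω ∈ Omega μ)
    (v : EuclideanSpace ℝ (Fin k)) :
    ∫ y, inner ℝ v y ∂(μ.tilted (inner ℝ ω)) = fderiv ℝ (psi μ) ω v := by
  have := isProbabilityMeasure_tilted_inner hμ hω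
  have hmean := deriv_cgf_zero (zero_mem_interior_integrableExpSet_inner hreg hω v)
  rw [probReal_univ, div_one, (cgf_inner_tilted_eventuallyEq hμ hreg hω v).deriv_eq,
    deriv_sub_const, ← iteratedDeriv_one,
    iteratedDeriv_comp_add_smul (contDiffAt_psi hμ hreg 1 hω), iteratedFDeriv_one_apply] at hmean
  exact hmean.symm

lemma variance_inner_tilted (hμ : μ ≠ 0) (hreg : IsRegular μ) (hω : ω ∈ Omega μ)
    (v : EuclideanSpace ℝ (Fin k)) :
    Var[inner ℝ v; μ.tilted (inner ℝ ω)] = iteratedFDeriv ℝ 2 (psi μ) ω fun _ => v := by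
  have := isProbabilityMeasure_tilted_inner hμ hω
  have hvar := variance_tilted_mul (zero_mem_interior_integrableExpSet_inner hreg hω v)
  simp only [zero_mul, tilted_const] at hvar
  rw [hvar, (cgf_inner_tilted_eventuallyEq hμ hreg hω v).iteratedDeriv_eq,
    ← iteratedDeriv_comp_add_smul (contDiffAt_psi hμ hreg 2 hω)]
  simp [iteratedDeriv_succ]

lemma iteratedFDeriv_two_psi_pos (hμ : μ ≠ 0) (hreg : IsRegular μ) (hmin : IsMinimal μ)
    (hω : ω ∈ Omega μ) {v : EuclideanSpace ℝ (Fin k)} (hv : v ≠ 0) :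
    0 < iteratedFDeriv ℝ 2 (psi μ) ω fun _ => v := by
  rw [← variance_inner_tilted hμ hreg hω]
  refine (variance_nonneg _ _).lt_of_ne fun h => ?_
  have := isProbabilityMeasure_tilted_inner hμ hω
  have hconst := ae_eq_integral_of_variance_eq_zero (memLp_inner_tilted hreg hω v) h.symm
  exact hmin v hv _ ((absolutelyContinuous_tilted hω).ae_le hconst)

end ExpFam

section ThirdDerivative

set_option maxSynthPendingDepth 3

section Polarization

variable {E : Type*} [NormedAddCommGroup E] [NormedSpace ℝ E] {T : E →L[ℝ] E →L[ℝ] E →L[ℝ] ℝ}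
  {κ : ℝ}

lemma trilinear_polarization (h₁₂ : ∀ a b c, T a b c = T b a c)
    (h₂₃ : ∀ a b c, T a b c = T a c b) (a b c : E) :
    24 * T a b c = T (a + b + c) (a + b + c) (a + b + c)
      - T (a + b - c) (a + b - c) (a + b - c) - T (a - b + c) (a - b + c) (a - b + c)
      - T (-a + b + c) (-a + b + c) (-a + b + c) := by
  have hacb : T a c b = T a b c := (h₂₃ a b c).symm
  have hbac : T b a c = T a b c := (h₁₂ a b c).symm
  have hbca : T b c a = T a b c := by rw [← h₂₃ b a c, hbac]
  have hcab : T c a b = T a b c := by rw [← h₁₂ a c b, hacb]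
  have hcba : T c b a = T a b c := by rw [← h₂₃ c a b, hcab]
  simp only [map_add, map_sub, map_neg, add_apply, sub_apply, neg_apply]
  rw [hacb, hbac, hbca, hcab, hcba]
  ring

lemma abs_trilinear_le_of_unit (hκ : 0 ≤ κ) (h₁₂ : ∀ a b c, T a b c = T b a c)
    (h₂₃ : ∀ a b c, T a b c = T a c b) (hT : ∀ u, T u u u ≤ κ * ‖u‖ ^ 3) {a b c : E}
    (ha : ‖a‖ = 1) (hb : ‖b‖ = 1) (hc : ‖c‖ = 1) : |T a b c| ≤ 5 * κ := by
  have hcube : ∀ u v w : E, ‖u‖ = 1 → ‖v‖ = 1 → ‖w‖ = 1 →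
      |T (u + v + w) (u + v + w) (u + v + w)| ≤ 27 * κ := by
    intro u v w hu hv hw
    have hnorm : ‖u + v + w‖ ≤ 3 := norm_add₃_le.trans (by rw [hu, hv, hw]; norm_num)
    have hpow : κ * ‖u + v + w‖ ^ 3 ≤ κ * 3 ^ 3 := by gcongr
    have hpos := hT (u + v + w)
    have hneg := hT (-(u + v + w))
    simp only [map_neg, neg_apply, neg_neg, norm_neg] at hneg
    exact abs_le.2 ⟨by linarith, by linarith⟩
  have h₀ := abs_le.1 (hcube a b c ha hb hc)
  have h₁ := abs_le.1 (hcube a b (-c) ha hb (by rwa [norm_neg]))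
  have h₂ := abs_le.1 (hcube a (-b) c ha (by rwa [norm_neg]) hc)
  have h₃ := abs_le.1 (hcube (-a) b c (by rwa [norm_neg]) hb hc)
  have hpol := trilinear_polarization h₁₂ h₂₃ a b c
  rw [sub_eq_add_neg (a + b) c, sub_eq_add_neg a b] at hpol
  exact abs_le.2 ⟨by linarith, by linarith⟩

lemma opNorm_le_of_symmetric_of_cube_le (hκ : 0 ≤ κ) (h₁₂ : ∀ a b c, T a b c = T b a c)
    (h₂₃ : ∀ a b c, T a b c = T a c b) (hT : ∀ u, T u u u ≤ κ * ‖u‖ ^ 3) : ‖T‖ ≤ 5 * κ := by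
  refine T.opNorm_le_bound (by positivity) fun a =>
    (T a).opNorm_le_bound₂ (by positivity) fun b c => ?_
  rcases eq_or_ne a 0 with rfl | ha
  · simp
  rcases eq_or_ne b 0 with rfl | hb
  · simp
  rcases eq_or_ne c 0 with rfl | hc
  · simp
  have hunit := abs_trilinear_le_of_unit hκ h₁₂ h₂₃ hT (norm_smul_inv_norm (𝕜 := ℝ) ha)
    (norm_smul_inv_norm (𝕜 := ℝ) hb) (norm_smul_inv_norm (𝕜 := ℝ) hc)
  have hpos := fun {u : E} (hu : u ≠ 0) => norm_pos_iff.2 hu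
  have := hpos ha
  have := hpos hb
  have := hpos hc
  simp only [RCLike.ofReal_real_eq_id, id_eq, map_smul, smul_apply, smul_eq_mul, abs_mul, abs_inv,
    abs_norm] at hunit
  field_simp at hunit
  rw [Real.norm_eq_abs]
  linarith

end Polarization

section Symmetry

variable {E F : Type*} [NormedAddCommGroup E] [NormedSpace ℝ E] [NormedAddCommGroup F]
  [NormedSpace ℝ F] {f : E → ℝ} {x : E} {R κ : ℝ}

lemma fderiv_fderiv_swap {f : E → F} (hf : ContDiffAt ℝ 2 f x) (a b : E) :
    fderiv ℝ (fderiv ℝ f) x a b = fderiv ℝ (fderiv ℝ f) x b a :=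
  (hf.isSymmSndFDerivAt (by simp)).eq a b

lemma iteratedFDeriv_three_apply (m : Fin 3 → E) :
    iteratedFDeriv ℝ 3 f x m = fderiv ℝ (fderiv ℝ (fderiv ℝ f)) x (m 0) (m 1) (m 2) := by
  rw [iteratedFDeriv_succ_apply_right, iteratedFDeriv_two_apply]
  rfl

lemma hasFDerivAt_fderiv_of_contDiffAt_three (hf : ContDiffAt ℝ 3 f x) :
    HasFDerivAt (fderiv ℝ f) (fderiv ℝ (fderiv ℝ f) x) x :=
  ((hf.fderiv_right (m := 2) (by norm_num)).differentiableAt (by simp)).hasFDerivAt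

lemma hasFDerivAt_fderiv_fderiv_of_contDiffAt_three (hf : ContDiffAt ℝ 3 f x) :
    HasFDerivAt (fderiv ℝ (fderiv ℝ f)) (fderiv ℝ (fderiv ℝ (fderiv ℝ f)) x) x :=
  (((hf.fderiv_right (m := 2) (by norm_num)).fderiv_right (m := 1) (by norm_num)).differentiableAt
    (by simp)).hasFDerivAt

lemma fderiv_three_swap_right (hf : ContDiffAt ℝ 3 f x) (a b c : E) :
    fderiv ℝ (fderiv ℝ (fderiv ℝ f)) x a b c = fderiv ℝ (fderiv ℝ (fderiv ℝ f)) x a c b := by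
  have happly : ∀ b c : E, HasFDerivAt (fun y => fderiv ℝ (fderiv ℝ f) y b c)
      (((fderiv ℝ (fderiv ℝ (fderiv ℝ f)) x).flip b).flip c) x := fun b c => by
    convert! ((hasFDerivAt_fderiv_fderiv_of_contDiffAt_three hf).clm_apply
      (hasFDerivAt_const b x)).clm_apply (hasFDerivAt_const c x) using 1
    ext a
    simp
  have hswap : (fun y => fderiv ℝ (fderiv ℝ f) y b c) =ᶠ[𝓝 x]
      fun y => fderiv ℝ (fderiv ℝ f) y c b := by
    filter_upwards [(hf.of_le (by norm_num : (2 : WithTop ℕ∞) ≤ 3)).eventually (by simp)] with y hy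
    exact fderiv_fderiv_swap hy b c
  exact congrArg (fun L : E →L[ℝ] ℝ => L a)
    ((happly b c).unique ((happly c b).congr_of_eventuallyEq hswap))

lemma norm_fderiv_three_le (hκ : 0 ≤ κ) (hf : ContDiffAt ℝ 3 f x)
    (hcube : ∀ u, iteratedFDeriv ℝ 3 f x (fun _ => u) ≤ κ * ‖u‖ ^ 3) :
    ‖fderiv ℝ (fderiv ℝ (fderiv ℝ f)) x‖ ≤ 5 * κ :=
  opNorm_le_of_symmetric_of_cube_le hκ
    (fun a b c => by rw [fderiv_fderiv_swap (hf.fderiv_right (m := 2) (by norm_num)) a b])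
    (fderiv_three_swap_right hf)
    fun u => (iteratedFDeriv_three_apply fun _ => u).symm.trans_le (hcube u)

lemma norm_fderiv_fderiv_sub_le (hκ : 0 ≤ κ)
    (hf : ∀ z ∈ Metric.closedBall x R, ContDiffAt ℝ 3 f z)
    (hcube : ∀ z ∈ Metric.closedBall x R, ∀ u,
      iteratedFDeriv ℝ 3 f z (fun _ => u) ≤ κ * ‖u‖ ^ 3) {z : E}
    (hz : z ∈ Metric.closedBall x R) :
    ‖fderiv ℝ (fderiv ℝ f) z - fderiv ℝ (fderiv ℝ f) x‖ ≤ 5 * κ * R := by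
  have hzx : ‖z - x‖ ≤ R := mem_closedBall_iff_norm.1 hz
  refine ((convex_closedBall x R).norm_image_sub_le_of_norm_hasFDerivWithin_le
    (fun y hy => (hasFDerivAt_fderiv_fderiv_of_contDiffAt_three (hf y hy)).hasFDerivWithinAt)
    (fun y hy => norm_fderiv_three_le hκ (hf y hy) (hcube y hy))
    (Metric.mem_closedBall_self ((norm_nonneg _).trans hzx)) hz).trans ?_
  gcongr

end Symmetry

section HessianAtOrigin

variable {E : Type*} [NormedAddCommGroup E] [InnerProductSpace ℝ E] {f : E → ℝ} {R κ : ℝ}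

lemma fderiv_fderiv_eq_innerSL {x : E} (hf : ContDiffAt ℝ 2 f x)
    (hhess : ∀ u, iteratedFDeriv ℝ 2 f x (fun _ => u) = ‖u‖ ^ 2) (a : E) :
    fderiv ℝ (fderiv ℝ f) x a = innerSL ℝ a := by
  have hquad : ∀ u, fderiv ℝ (fderiv ℝ f) x u u = ‖u‖ ^ 2 := fun u =>
    (iteratedFDeriv_two_apply f x fun _ => u).symm.trans (hhess u)
  ext b
  have hadd := hquad (a + b)
  simp only [map_add, add_apply] at hadd
  rw [hquad, hquad, fderiv_fderiv_swap hf b a, norm_add_sq_real] at hadd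
  rw [innerSL_apply_apply ℝ]
  linarith

lemma nearlyQuadratic_of_iteratedFDeriv_three_le {τ : NNReal} (hR : 0 ≤ R) (hκ : 0 ≤ κ)
    (hτ : 5 * κ * R ≤ τ) (hf : ∀ z ∈ Metric.closedBall (0 : E) R, ContDiffAt ℝ 3 f z)
    (hhess : ∀ u, iteratedFDeriv ℝ 2 f 0 (fun _ => u) = ‖u‖ ^ 2)
    (hcube : ∀ z ∈ Metric.closedBall (0 : E) R, ∀ u,
      iteratedFDeriv ℝ 3 f z (fun _ => u) ≤ κ * ‖u‖ ^ 3) :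
    NearlyQuadratic f R τ where
  differentiableAt z hz := (hf z hz).differentiableAt (by simp)
  lipschitzOnWith := by
    have hhess0 := fderiv_fderiv_eq_innerSL
      ((hf 0 (Metric.mem_closedBall_self hR)).of_le (by norm_num)) hhess
    simp only [← hhess0]
    refine (convex_closedBall (0 : E) R).lipschitzOnWith_of_nnnorm_hasFDerivWithin_le
      (fun z hz => ((hasFDerivAt_fderiv_of_contDiffAt_three (hf z hz)).sub
        (fderiv ℝ (fderiv ℝ f) 0).hasFDerivAt).hasFDerivWithinAt) fun z hz => ?_
    rw [← NNReal.coe_le_coe, coe_nnnorm]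
    exact (norm_fderiv_fderiv_sub_le hκ hf hcube hz).trans hτ

end HessianAtOrigin

end ThirdDerivative

section Whitening

section Matrix

open scoped MatrixOrder

variable {d : ℕ} {A : Matrix (Fin d) (Fin d) ℝ}

lemma sqrt_inv_mul_sqrt_inv_mul (hA : A.PosDef) : CFC.sqrt A⁻¹ * (CFC.sqrt A⁻¹ * A) = 1 := by
  rw [← mul_assoc, CFC.sqrt_mul_sqrt_self _ hA.inv.posSemidef.nonneg,
    Matrix.nonsing_inv_mul _ ((Matrix.isUnit_iff_isUnit_det _).1 hA.isUnit)]

lemma transpose_sqrt (A : Matrix (Fin d) (Fin d) ℝ) : (CFC.sqrt A)ᵀ = CFC.sqrt A := by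
  have hself := (CFC.sqrt_nonneg A).isSelfAdjoint.star_eq
  rwa [Matrix.star_eq_conjTranspose, Matrix.conjTranspose_eq_transpose_of_trivial] at hself

/-- The linear map `A^{-1/2}`: coordinates in which the norm `|·|_A` becomes the Euclidean one. -/
noncomputable def whitening (hA : A.PosDef) :
    EuclideanSpace ℝ (Fin d) ≃L[ℝ] EuclideanSpace ℝ (Fin d) :=
  .equivOfInverse (Matrix.toEuclideanCLM (𝕜 := ℝ) (CFC.sqrt A⁻¹))
    (Matrix.toEuclideanCLM (𝕜 := ℝ) (CFC.sqrt A⁻¹ * A))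
    (fun z => by
      rw [← mul_apply_eq_comp, ← map_mul, mul_eq_one_comm.1 (sqrt_inv_mul_sqrt_inv_mul hA), map_one,
        one_apply_eq_self])
    (fun z => by
      rw [← mul_apply_eq_comp, ← map_mul, sqrt_inv_mul_sqrt_inv_mul hA, map_one,
        one_apply_eq_self])

lemma dotProduct_mulVec_whitening (hA : A.PosDef) (z : EuclideanSpace ℝ (Fin d)) :
    (whitening hA z).ofLp ⬝ᵥ A *ᵥ (whitening hA z).ofLp = ‖z‖ ^ 2 := by
  have happly : (whitening hA z).ofLp = CFC.sqrt A⁻¹ *ᵥ z.ofLp := rfl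
  have hone : CFC.sqrt A⁻¹ * A * CFC.sqrt A⁻¹ = 1 :=
    mul_eq_one_comm.1 (sqrt_inv_mul_sqrt_inv_mul hA)
  rw [happly, Matrix.mulVec_mulVec, Matrix.dotProduct_mulVec, ← Matrix.mulVec_transpose,
    Matrix.mulVec_mulVec, Matrix.transpose_mul, transpose_sqrt,
    ← Matrix.conjTranspose_eq_transpose_of_trivial A, hA.isHermitian.eq, hone,
    Matrix.one_mulVec, EuclideanSpace.real_norm_sq_eq]
  simp [dotProduct, sq]

lemma wnorm_whitening (hA : A.PosDef) (z : EuclideanSpace ℝ (Fin d)) :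
    wnorm A (whitening hA z) = ‖z‖ := by
  rw [wnorm, dotProduct_mulVec_whitening, Real.sqrt_sq (norm_nonneg z)]

lemma multivariateGaussian_inv_whitening (hA : A.PosDef) (x y : EuclideanSpace ℝ (Fin d)) :
    multivariateGaussian (x + whitening hA y) A⁻¹ =
      ((stdGaussian (EuclideanSpace ℝ (Fin d))).map (y + ·)).map fun z => x + whitening hA z := by
  rw [multivariateGaussian, Measure.map_map (by fun_prop) (by fun_prop)]
  congr 1
  ext1 z
  simp only [Function.comp_apply, map_add, add_assoc]
  rfl

lemma wnorm_smul_left (A : Matrix (Fin d) (Fin d) ℝ) {c : ℝ} (hc : 0 ≤ c)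
    (u : EuclideanSpace ℝ (Fin d)) : wnorm (c • A) u = √c * wnorm A u := by
  rw [wnorm, wnorm, Matrix.smul_mulVec, dotProduct_smul, smul_eq_mul, Real.sqrt_mul hc]

lemma wnorm_smul (A : Matrix (Fin d) (Fin d) ℝ) (c : ℝ) (u : EuclideanSpace ℝ (Fin d)) :
    wnorm A (c • u) = |c| * wnorm A u := by
  rw [wnorm, wnorm, WithLp.ofLp_smul, Matrix.mulVec_smul, smul_dotProduct, dotProduct_smul,
    smul_smul, smul_eq_mul, ← sq, Real.sqrt_mul (sq_nonneg c), Real.sqrt_sq_eq_abs]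

lemma wnorm_pos (hA : A.PosDef) {u : EuclideanSpace ℝ (Fin d)} (hu : u ≠ 0) : 0 < wnorm A u :=
  Real.sqrt_pos.2 (by simpa using hA.dotProduct_mulVec_pos (x := u.ofLp) (by simpa using hu))

lemma inner_le_of_dualNorm_le (hA : A.PosDef) {g : EuclideanSpace ℝ (Fin d)} {c : ℝ} (hc : 0 ≤ c)
    (h : dualNorm A g ≤ ENNReal.ofReal c) (u : EuclideanSpace ℝ (Fin d)) :
    inner ℝ g u ≤ c * wnorm A u := by
  rcases eq_or_ne u 0 with rfl | hu
  · simp [wnorm]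
  have hw : 0 < wnorm A u := wnorm_pos hA hu
  have hunit : wnorm A ((wnorm A u)⁻¹ • u) = 1 := by
    rw [wnorm_smul, abs_inv, abs_of_pos hw, inv_mul_cancel₀ hw.ne']
  have hle : ENNReal.ofReal (inner ℝ g ((wnorm A u)⁻¹ • u)) ≤ ENNReal.ofReal c :=
    (le_iSup₂_of_le (f := fun v (_ : wnorm A v = 1) => ENNReal.ofReal (inner ℝ g v))
      _ hunit le_rfl).trans h
  rw [ENNReal.ofReal_le_ofReal_iff hc, real_inner_smul_right, inv_mul_le_iff₀ hw] at hle
  linarith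

lemma dotProduct_hessian_mulVec {k : ℕ} (f : EuclideanSpace ℝ (Fin k) → ℝ)
    (x v w : EuclideanSpace ℝ (Fin k)) :
    v.ofLp ⬝ᵥ hessian f x *ᵥ w.ofLp = fderiv ℝ (fderiv ℝ f) x v w := by
  have hcoord (u : EuclideanSpace ℝ (Fin k)) :
      u = ∑ a, u a • EuclideanSpace.single a (1 : ℝ) := by
    simpa using ((EuclideanSpace.basisFun (Fin k) ℝ).sum_repr u).symm
  conv_rhs => rw [hcoord v, hcoord w]
  simp only [map_sum, map_smul, sum_apply, smul_apply, smul_eq_mul, dotProduct, Matrix.mulVec,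
    hessian, Matrix.of_apply, iteratedFDeriv_two_apply, Matrix.cons_val_zero, Matrix.cons_val_one,
    Finset.mul_sum]
  rw [Finset.sum_comm]
  exact Finset.sum_congr rfl fun a _ => Finset.sum_congr rfl fun b _ => by ring

end Matrix

section ChangeOfVariables

lemma map_withDensity_comp {α β : Type*} [MeasurableSpace α] [MeasurableSpace β] (φ : α ≃ᵐ β)
    (μ : Measure α) (f : β → ℝ≥0∞) :
    (μ.withDensity fun x => f (φ x)).map φ = (μ.map φ).withDensity f := by
  ext A hA
  rw [φ.map_apply, withDensity_apply _ (φ.measurable hA), withDensity_apply _ hA, φ.restrict_map,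
    lintegral_map_equiv]

lemma inv_univ_smul_smul {α : Type*} [MeasurableSpace α] {c : ℝ≥0∞} (hc : c ≠ 0) (hc' : c ≠ ∞)
    (μ : Measure α) : ((c • μ) Set.univ)⁻¹ • c • μ = (μ Set.univ)⁻¹ • μ := by
  rw [Measure.smul_apply, smul_eq_mul, ENNReal.mul_inv (.inl hc) (.inl hc'), smul_smul,
    mul_right_comm, ENNReal.inv_mul_cancel hc hc', one_mul]

variable {E : Type*} [NormedAddCommGroup E] [NormedSpace ℝ E] [FiniteDimensional ℝ E]
  [MeasurableSpace E] [BorelSpace E]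

lemma exists_map_add_clm_eq_smul (μ : Measure E) [μ.IsAddHaarMeasure] (x : E) (W : E ≃L[ℝ] E) :
    ∃ c : ℝ≥0∞, c ≠ 0 ∧ c ≠ ∞ ∧ μ.map (fun z => x + W z) = c • μ := by
  have hdet : LinearMap.det W.toLinearEquiv.toLinearMap ≠ 0 := W.toLinearEquiv.isUnit_det'.ne_zero
  have hmeas : Measurable W.toLinearEquiv.toLinearMap := W.continuous.measurable
  have hcomp : (fun z => x + W z) = (x + ·) ∘ W.toLinearEquiv.toLinearMap := rfl
  refine ⟨ENNReal.ofReal |(LinearMap.det W.toLinearEquiv.toLinearMap)⁻¹|, by simpa using hdet,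
    ENNReal.ofReal_ne_top, ?_⟩
  rw [hcomp, ← Measure.map_map (measurable_const_add x) hmeas,
    Measure.map_linearMap_addHaar_eq_smul_addHaar _ hdet, Measure.map_smul, map_add_left_eq_self]

end ChangeOfVariables

end Whitening

namespace GLM

section Model

variable {n d k : ℕ} (M : GLM n d k)

/-- The linear predictor `θ ↦ X_iᵀ θ` as a continuous linear map. -/
noncomputable def predL (i : Fin n) : EuclideanSpace ℝ (Fin d) →L[ℝ] EuclideanSpace ℝ (Fin k) :=
  LinearMap.toContinuousLinearMap (Matrix.toEuclideanLin (M.X i)ᵀ)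

lemma pred_eq_predL (i : Fin n) : M.pred i = M.predL i := rfl

lemma Theta_eq_iInter : M.Theta = ⋂ i, M.predL i ⁻¹' ExpFam.Omega M.base := by
  ext θ
  simp [Theta, pred_eq_predL]

lemma convex_Theta : Convex ℝ M.Theta := by
  rw [Theta_eq_iInter]
  exact convex_iInter fun i => ExpFam.convex_Omega.linear_preimage (M.predL i).toLinearMap

lemma exists_pred_ne_zero
    (hspan : Submodule.span ℝ (Set.range fun p : Fin n × Fin k => (M.X p.1).col p.2) = ⊤)
    {u : EuclideanSpace ℝ (Fin d)} (hu : u ≠ 0) : ∃ i, M.pred i u ≠ 0 := by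
  by_contra! h
  have hzero : dotProductBilin ℝ ℝ u.ofLp = 0 := by
    refine LinearMap.ext_on_range (v := fun p : Fin n × Fin k => (M.X p.1).col p.2) hspan ?_
    rintro ⟨i, j⟩
    have hij : (M.X i).col j ⬝ᵥ u.ofLp = 0 :=
      congrArg (fun v : EuclideanSpace ℝ (Fin k) => v j) (h i)
    exact (dotProduct_comm _ _).trans hij
  have hself : u.ofLp ⬝ᵥ u.ofLp = 0 := congrArg (fun f => f u.ofLp) hzero
  exact hu (by simpa using hself)

lemma dotProduct_fisher_mulVec (u v : EuclideanSpace ℝ (Fin d)) :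
    u.ofLp ⬝ᵥ M.fisher *ᵥ v.ofLp = (n : ℝ)⁻¹ * ∑ i,
      fderiv ℝ (fderiv ℝ (ExpFam.psi M.base)) (M.pred i M.truth) (M.pred i u) (M.pred i v) := by
  rw [fisher, Matrix.smul_mulVec, dotProduct_smul, smul_eq_mul, Matrix.sum_mulVec, dotProduct_sum]
  congr 1
  refine Finset.sum_congr rfl fun i _ => ?_
  rw [← dotProduct_hessian_mulVec, ← Matrix.mulVec_mulVec, ← Matrix.mulVec_mulVec,
    Matrix.dotProduct_mulVec, ← Matrix.mulVec_transpose]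
  rfl

lemma dotProduct_fisher_mulVec_self (u : EuclideanSpace ℝ (Fin d)) :
    u.ofLp ⬝ᵥ M.fisher *ᵥ u.ofLp = (n : ℝ)⁻¹ * ∑ i,
      iteratedFDeriv ℝ 2 (ExpFam.psi M.base) (M.pred i M.truth) fun _ => M.pred i u := by
  simp_rw [dotProduct_fisher_mulVec, iteratedFDeriv_two_apply]

/-- The function `θ ↦ ∑ᵢ ψ(X_iᵀ θ)`, the nonlinear part of the log likelihood. -/
noncomputable def logPartition (θ : EuclideanSpace ℝ (Fin d)) : ℝ :=
  ∑ i, ExpFam.psi M.base (M.pred i θ)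

/-- The linear functional `θ ↦ ∑ᵢ ⟨Y_i, X_iᵀ θ⟩`, the linear part of the log likelihood. -/
noncomputable def suffStat (Y : Fin n → EuclideanSpace ℝ (Fin k)) :
    EuclideanSpace ℝ (Fin d) →L[ℝ] ℝ :=
  ∑ i, (innerSL ℝ (Y i)).comp (M.predL i)

/-- The score: the derivative at the ground truth of the unnormalized negative log likelihood
`n ℓ`. -/
noncomputable def score (Y : Fin n → EuclideanSpace ℝ (Fin k)) :
    EuclideanSpace ℝ (Fin d) →L[ℝ] ℝ :=
  fderiv ℝ M.logPartition M.truth - M.suffStat Y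

lemma suffStat_apply (Y : Fin n → EuclideanSpace ℝ (Fin k)) (θ : EuclideanSpace ℝ (Fin d)) :
    M.suffStat Y θ = ∑ i, inner ℝ (M.pred i θ) (Y i) := by
  simp [suffStat, pred_eq_predL, real_inner_comm]

lemma natCast_mul_nll (Y : Fin n → EuclideanSpace ℝ (Fin k)) (θ : EuclideanSpace ℝ (Fin d)) :
    (n : ℝ) * M.nll Y θ = M.logPartition θ - M.suffStat Y θ := by
  rcases eq_or_ne n 0 with rfl | hn
  · simp [logPartition, suffStat]
  have hn' : (n : ℝ) ≠ 0 := Nat.cast_ne_zero.2 hn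
  simp only [nll, ExpFam.density]
  rw [Real.log_prod fun i _ => (Real.exp_pos _).ne', suffStat_apply, logPartition, neg_mul, mul_neg,
    mul_inv_cancel_left₀ hn']
  simp only [Real.log_exp, Finset.sum_sub_distrib]
  ring

variable {M}

lemma convexOn_natCast_mul_nll (hμ : M.base ≠ 0) (Y : Fin n → EuclideanSpace ℝ (Fin k)) :
    ConvexOn ℝ M.Theta fun θ => (n : ℝ) * M.nll Y θ := by
  have hterm (i : Fin n) : ConvexOn ℝ M.Theta fun θ => ExpFam.psi M.base (M.pred i θ) :=
    ((ExpFam.convexOn_psi hμ).comp_linearMap (M.predL i).toLinearMap).subset (fun _ hθ => hθ i)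
      M.convex_Theta
  have hsum : ConvexOn ℝ M.Theta M.logPartition := by
    refine ⟨M.convex_Theta, fun x hx y hy a b ha hb hab => ?_⟩
    simp only [logPartition, Finset.smul_sum, ← Finset.sum_add_distrib]
    exact Finset.sum_le_sum fun i _ => (hterm i).2 hx hy ha hb hab
  simp_rw [natCast_mul_nll]
  exact hsum.sub ((M.suffStat Y).toLinearMap.concaveOn M.convex_Theta)

/-- The standing assumptions on a single model. -/
structure Regular (M : GLM n d k) : Prop where
  n_pos : 0 < n
  d_pos : 0 < d
  isRegular : ExpFam.IsRegular M.base
  isMinimal : ExpFam.IsMinimal M.base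
  truth_mem : M.truth ∈ M.Theta
  span_eq_top :
    Submodule.span ℝ (Set.range fun p : Fin n × Fin k => (M.X p.1).col p.2) = ⊤
  prior_pos : ∀ θ ∈ M.Theta, 0 < M.prior θ

namespace Regular

variable (hM : M.Regular)
include hM

lemma base_ne_zero : M.base ≠ 0 := by
  intro h
  obtain ⟨i, hi⟩ := M.exists_pred_ne_zero hM.span_eq_top
    (u := EuclideanSpace.single (⟨0, hM.d_pos⟩ : Fin d) (1 : ℝ)) (by simp)
  exact hM.isMinimal _ hi 0 (by simp [h])

lemma isOpen_Theta : IsOpen M.Theta := by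
  rw [Theta_eq_iInter]
  exact isOpen_iInter_of_finite fun i => hM.isRegular.preimage (M.predL i).continuous

lemma dotProduct_fisher_mulVec_pos {u : EuclideanSpace ℝ (Fin d)} (hu : u ≠ 0) :
    0 < u.ofLp ⬝ᵥ M.fisher *ᵥ u.ofLp := by
  have hpos {i : Fin n} (hi : M.pred i u ≠ 0) : 0 < iteratedFDeriv ℝ 2 (ExpFam.psi M.base)
      (M.pred i M.truth) fun _ => M.pred i u :=
    ExpFam.iteratedFDeriv_two_psi_pos hM.base_ne_zero hM.isRegular hM.isMinimal (hM.truth_mem i) hi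
  obtain ⟨i, hi⟩ := M.exists_pred_ne_zero hM.span_eq_top hu
  rw [dotProduct_fisher_mulVec_self]
  refine mul_pos (inv_pos.2 (Nat.cast_pos.2 hM.n_pos))
    (Finset.sum_pos' (fun j _ => ?_) ⟨i, Finset.mem_univ _, hpos hi⟩)
  rcases eq_or_ne (M.pred j u) 0 with hj | hj
  · exact (ContinuousMultilinearMap.map_coord_zero _ 0 hj).ge
  · exact (hpos hj).le

lemma posDef_fisher : M.fisher.PosDef := by
  refine Matrix.PosDef.of_dotProduct_mulVec_pos ?_ fun x hx => ?_
  · have hsymm (u v : EuclideanSpace ℝ (Fin d)) :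
        u.ofLp ⬝ᵥ M.fisher *ᵥ v.ofLp = v.ofLp ⬝ᵥ M.fisher *ᵥ u.ofLp := by
      simp_rw [dotProduct_fisher_mulVec]
      congr 1
      exact Finset.sum_congr rfl fun i _ => fderiv_fderiv_swap
        (ExpFam.contDiffAt_psi hM.base_ne_zero hM.isRegular 2 (hM.truth_mem i)) _ _
    ext a b
    simpa using hsymm (EuclideanSpace.single b 1) (EuclideanSpace.single a 1)
  · simpa using hM.dotProduct_fisher_mulVec_pos (u := WithLp.toLp 2 x) (by simpa using hx)

lemma posDef_smul_fisher : ((n : ℝ) • M.fisher).PosDef :=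
  hM.posDef_fisher.smul (Nat.cast_pos.2 hM.n_pos)

lemma contDiffAt_logPartition (m : ℕ) {θ : EuclideanSpace ℝ (Fin d)} (hθ : θ ∈ M.Theta) :
    ContDiffAt ℝ m M.logPartition θ := by
  unfold logPartition
  exact ContDiffAt.sum fun i _ =>
    (ExpFam.contDiffAt_psi hM.base_ne_zero hM.isRegular m (hθ i)).comp θ
      (M.predL i).contDiff.contDiffAt

lemma iteratedFDeriv_logPartition (m : ℕ) {θ : EuclideanSpace ℝ (Fin d)} (hθ : θ ∈ M.Theta)
    (u : EuclideanSpace ℝ (Fin d)) :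
    iteratedFDeriv ℝ m M.logPartition θ (fun _ => u) =
      ∑ i, iteratedFDeriv ℝ m (ExpFam.psi M.base) (M.pred i θ) fun _ => M.pred i u := by
  have hpsi (i : Fin n) : ContDiffAt ℝ m (ExpFam.psi M.base) (0 + M.predL i θ) := by
    rw [zero_add]
    exact ExpFam.contDiffAt_psi hM.base_ne_zero hM.isRegular m (hθ i)
  have hterm (i : Fin n) : ContDiffAt ℝ m (fun θ => ExpFam.psi M.base (0 + M.predL i θ)) θ :=
    ContDiffAt.comp (g := ExpFam.psi M.base) θ (hpsi i) (by fun_prop)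
  have hsum : M.logPartition = fun θ => ∑ i, ExpFam.psi M.base (0 + M.predL i θ) := by
    simp only [zero_add]
    rfl
  rw [hsum, iteratedFDeriv_fun_sum_apply fun i _ => hterm i, sum_apply]
  refine Finset.sum_congr rfl fun i _ => ?_
  rw [iteratedFDeriv_comp_add_clm _ (hpsi i), zero_add]
  rfl

lemma iteratedFDeriv_two_logPartition_truth (u : EuclideanSpace ℝ (Fin d)) :
    iteratedFDeriv ℝ 2 M.logPartition M.truth (fun _ => u) =
      u.ofLp ⬝ᵥ ((n : ℝ) • M.fisher) *ᵥ u.ofLp := by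
  rw [hM.iteratedFDeriv_logPartition 2 hM.truth_mem, Matrix.smul_mulVec, dotProduct_smul,
    smul_eq_mul, dotProduct_fisher_mulVec_self,
    mul_inv_cancel_left₀ (Nat.cast_ne_zero.2 hM.n_pos.ne')]

lemma iteratedFDeriv_three_logPartition_le {s c : ℝ} (hc : 0 ≤ c)
    (h : M.delta3 s ≤ ENNReal.ofReal c) {θ : EuclideanSpace ℝ (Fin d)} (hθ : θ ∈ M.nbhd s)
    (hθ' : θ ∈ M.Theta) (u : EuclideanSpace ℝ (Fin d)) :
    iteratedFDeriv ℝ 3 M.logPartition θ (fun _ => u) ≤ n * c * wnorm M.fisher u ^ 3 := by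
  rcases eq_or_ne u 0 with rfl | hu
  · rw [(iteratedFDeriv ℝ 3 M.logPartition θ).map_coord_zero 0 rfl]
    exact mul_nonneg (by positivity) (pow_nonneg (Real.sqrt_nonneg _) 3)
  have hpos : 0 < u.ofLp ⬝ᵥ M.fisher *ᵥ u.ofLp := hM.dotProduct_fisher_mulVec_pos hu
  have hpow : (u.ofLp ⬝ᵥ M.fisher *ᵥ u.ofLp) ^ (3 / 2 : ℝ) = wnorm M.fisher u ^ 3 := by
    rw [wnorm, Real.sqrt_eq_rpow, ← Real.rpow_natCast, ← Real.rpow_mul hpos.le]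
    norm_num
  have hw : 0 < wnorm M.fisher u := wnorm_pos hM.posDef_fisher hu
  have hratio := (le_iSup₂_of_le θ hθ (le_iSup₂_of_le u hu le_rfl)).trans h
  rw [← dotProduct_fisher_mulVec_self, hpow, ← hM.iteratedFDeriv_logPartition 3 hθ',
    ENNReal.ofReal_le_ofReal_iff hc, div_le_iff₀ (pow_pos hw 3),
    inv_mul_le_iff₀ (Nat.cast_pos.2 hM.n_pos), ← mul_assoc] at hratio
  exact hratio

end Regular

end Model

end GLM

section Sub

variable {E : Type*} [NormedAddCommGroup E] [InnerProductSpace ℝ E]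

lemma NearlyQuadratic.sub_clm {G : E → ℝ} {R : ℝ} {τ : NNReal} (h : NearlyQuadratic G R τ)
    (ℓ : E →L[ℝ] ℝ) (c : ℝ) : NearlyQuadratic (fun z => G z - (c + ℓ z)) R τ where
  differentiableAt z hz := (h.differentiableAt z hz).sub (ℓ.differentiableAt.const_add c)
  lipschitzOnWith x hx y hy := by
    have hderiv {z : E} (hz : z ∈ Metric.closedBall 0 R) :
        fderiv ℝ (fun z => G z - (c + ℓ z)) z = fderiv ℝ G z - ℓ :=
      ((h.differentiableAt z hz).hasFDerivAt.sub (ℓ.hasFDerivAt.const_add c)).fderiv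
    have hle := h.lipschitzOnWith hx hy
    rw [edist_eq_enorm_sub] at hle ⊢
    dsimp only at hle ⊢
    rwa [hderiv hx, hderiv hy, sub_right_comm (fderiv ℝ G x) ℓ, sub_right_comm (fderiv ℝ G y) ℓ,
      sub_sub_sub_cancel_right]

lemma lipschitzOnWith_of_fderiv_le {f : E → ℝ} {s : Set E} (hs : Convex ℝ s) {c : NNReal}
    (hf : ∀ x ∈ s, DifferentiableAt ℝ f x) (hle : ∀ x ∈ s, ∀ u, fderiv ℝ f x u ≤ c * ‖u‖) :
    LipschitzOnWith c f s := by
  refine hs.lipschitzOnWith_of_nnnorm_fderiv_le hf fun x hx => ?_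
  refine ContinuousLinearMap.opNorm_le_bound _ c.coe_nonneg fun u => abs_le.2 ⟨?_, hle x hx u⟩
  have hneg := hle x hx (-u)
  rw [map_neg, norm_neg] at hneg
  exact neg_le.1 hneg

end Sub

namespace GLM.Regular

section Whitened

variable {n d k : ℕ} {M : GLM n d k} (hM : M.Regular)

/-- The affine coordinates `z ↦ θ* + (n F*)^{-1/2} z`, in which the truth is the origin and
`n F*` is the identity. -/
noncomputable def reparam : EuclideanSpace ℝ (Fin d) ≃ₜ EuclideanSpace ℝ (Fin d) :=
  (whitening hM.posDef_smul_fisher).toHomeomorph.trans (Homeomorph.addLeft M.truth)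

/-- The score in the coordinates `reparam`, where its covariance is the identity. -/
noncomputable def whitenedScore (Y : Fin n → EuclideanSpace ℝ (Fin k)) :
    EuclideanSpace ℝ (Fin d) →L[ℝ] ℝ :=
  (M.score Y).comp (whitening hM.posDef_smul_fisher).toContinuousLinearMap

lemma reparam_apply (z : EuclideanSpace ℝ (Fin d)) :
    hM.reparam z = M.truth + whitening hM.posDef_smul_fisher z := rfl

lemma reparam_zero : hM.reparam 0 = M.truth := by
  rw [reparam_apply, map_zero, add_zero]

lemma hasFDerivAt_reparam (z : EuclideanSpace ℝ (Fin d)) :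
    HasFDerivAt hM.reparam (whitening hM.posDef_smul_fisher).toContinuousLinearMap z :=
  (whitening hM.posDef_smul_fisher).hasFDerivAt.const_add M.truth

lemma wnorm_fisher_whitening (z : EuclideanSpace ℝ (Fin d)) :
    wnorm M.fisher (whitening hM.posDef_smul_fisher z) = ‖z‖ / √n := by
  have hn : 0 < √(n : ℝ) := Real.sqrt_pos.2 (Nat.cast_pos.2 hM.n_pos)
  rw [eq_div_iff hn.ne', mul_comm, ← wnorm_smul_left _ n.cast_nonneg, wnorm_whitening]

lemma reparam_mem_nbhd {s : ℝ} {z : EuclideanSpace ℝ (Fin d)}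
    (hz : z ∈ Metric.closedBall (0 : EuclideanSpace ℝ (Fin d)) (s * √d)) :
    hM.reparam z ∈ M.nbhd s := by
  rw [mem_closedBall_zero_iff] at hz
  change wnorm M.fisher (M.truth + whitening hM.posDef_smul_fisher z - M.truth) ≤ s * √(d / n)
  rw [add_sub_cancel_left, hM.wnorm_fisher_whitening, Real.sqrt_div (Nat.cast_nonneg d),
    ← mul_div_assoc]
  gcongr

lemma contDiffAt_comp_reparam {f : EuclideanSpace ℝ (Fin d) → ℝ} {m : ℕ}
    {z : EuclideanSpace ℝ (Fin d)} (hf : ContDiffAt ℝ m f (hM.reparam z)) :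
    ContDiffAt ℝ m (fun z => f (hM.reparam z)) z :=
  hf.comp z (contDiffAt_const.add (whitening hM.posDef_smul_fisher).contDiff.contDiffAt)

lemma iteratedFDeriv_comp_reparam {f : EuclideanSpace ℝ (Fin d) → ℝ} {m : ℕ}
    {z : EuclideanSpace ℝ (Fin d)} (hf : ContDiffAt ℝ m f (hM.reparam z))
    (u : EuclideanSpace ℝ (Fin d)) :
    iteratedFDeriv ℝ m (fun z => f (hM.reparam z)) z (fun _ => u) =
      iteratedFDeriv ℝ m f (hM.reparam z) fun _ => whitening hM.posDef_smul_fisher u :=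
  iteratedFDeriv_comp_add_clm (whitening hM.posDef_smul_fisher).toContinuousLinearMap hf _

lemma nearlyQuadratic_logPartition {s c : ℝ} {τ : NNReal} (hs : 0 ≤ s) (hc : 0 ≤ c)
    (hsub : M.nbhd s ⊆ M.Theta) (hdelta : M.delta3 s ≤ ENNReal.ofReal c)
    (hτ : 5 * (c / √n) * (s * √d) ≤ τ) :
    NearlyQuadratic (fun z => M.logPartition (hM.reparam z)) (s * √d) τ := by
  have hn : (0 : ℝ) < n := Nat.cast_pos.2 hM.n_pos
  have hsmooth {z : EuclideanSpace ℝ (Fin d)}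
      (hz : z ∈ Metric.closedBall (0 : EuclideanSpace ℝ (Fin d)) (s * √d)) (m : ℕ) :
      ContDiffAt ℝ m M.logPartition (hM.reparam z) :=
    hM.contDiffAt_logPartition m (hsub (hM.reparam_mem_nbhd hz))
  refine nearlyQuadratic_of_iteratedFDeriv_three_le (by positivity) (by positivity) hτ
    (fun z hz => hM.contDiffAt_comp_reparam (hsmooth hz 3)) (fun u => ?_) fun z hz u => ?_
  · rw [hM.iteratedFDeriv_comp_reparam (hsmooth (Metric.mem_closedBall_self (by positivity)) 2),
      reparam_zero, hM.iteratedFDeriv_two_logPartition_truth, dotProduct_mulVec_whitening]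
  · have hmem := hM.reparam_mem_nbhd hz
    rw [hM.iteratedFDeriv_comp_reparam (hsmooth hz 3)]
    refine (hM.iteratedFDeriv_three_logPartition_le hc hdelta hmem (hsub hmem) _).trans_eq ?_
    rw [hM.wnorm_fisher_whitening]
    nth_rewrite 1 [← Real.sq_sqrt hn.le]
    field_simp

lemma nearlyQuadratic_nll {s c : ℝ} {τ : NNReal} (hs : 0 ≤ s) (hc : 0 ≤ c)
    (hsub : M.nbhd s ⊆ M.Theta) (hdelta : M.delta3 s ≤ ENNReal.ofReal c)
    (hτ : 5 * (c / √n) * (s * √d) ≤ τ) (Y : Fin n → EuclideanSpace ℝ (Fin k)) :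
    NearlyQuadratic (fun z => (n : ℝ) * M.nll Y (hM.reparam z)) (s * √d) τ := by
  simp_rw [natCast_mul_nll, reparam_apply, map_add]
  exact (hM.nearlyQuadratic_logPartition hs hc hsub hdelta hτ).sub_clm
    ((M.suffStat Y).comp (whitening hM.posDef_smul_fisher).toContinuousLinearMap)
    (M.suffStat Y M.truth)

lemma convexOn_nll_reparam (Y : Fin n → EuclideanSpace ℝ (Fin k)) :
    ConvexOn ℝ (hM.reparam ⁻¹' M.Theta) fun z => (n : ℝ) * M.nll Y (hM.reparam z) :=
  ((convexOn_natCast_mul_nll hM.base_ne_zero Y).translate_right M.truth).comp_linearMap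
    (whitening hM.posDef_smul_fisher).toLinearMap

lemma fderiv_nll_reparam_zero (Y : Fin n → EuclideanSpace ℝ (Fin k)) :
    fderiv ℝ (fun z => (n : ℝ) * M.nll Y (hM.reparam z)) 0 = hM.whitenedScore Y := by
  have hlog : HasFDerivAt M.logPartition (fderiv ℝ M.logPartition M.truth) (hM.reparam 0) := by
    rw [reparam_zero]
    exact ((hM.contDiffAt_logPartition 1 hM.truth_mem).differentiableAt (by simp)).hasFDerivAt
  simp_rw [natCast_mul_nll]
  exact ((hlog.sub (M.suffStat Y).hasFDerivAt).comp 0 (hM.hasFDerivAt_reparam 0)).fderiv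

lemma lipschitzOnWith_log_prior {s : ℝ} {η : NNReal}
    (hη : M.delta01 s ≤ ENNReal.ofReal (η * √n)) :
    LipschitzOnWith η (fun z => Real.log (M.prior (hM.reparam z)))
      (Metric.closedBall 0 (s * √d)) := by
  have hn : 0 < √(n : ℝ) := Real.sqrt_pos.2 (Nat.cast_pos.2 hM.n_pos)
  have hsmooth : ∀ θ ∈ M.nbhd s, ContDiffAt ℝ 1 M.prior θ ∧ 0 < M.prior θ := by
    by_contra h
    rw [delta01, if_neg h] at hη
    exact ENNReal.ofReal_ne_top (top_le_iff.1 hη)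
  have hderiv {z : EuclideanSpace ℝ (Fin d)} (hz : hM.reparam z ∈ M.nbhd s) :
      HasFDerivAt (fun z => Real.log (M.prior (hM.reparam z)))
        ((fderiv ℝ (fun θ => Real.log (M.prior θ)) (hM.reparam z)).comp
          (whitening hM.posDef_smul_fisher).toContinuousLinearMap) z :=
    (((hsmooth _ hz).1.differentiableAt (by simp)).log
      (hsmooth _ hz).2.ne').hasFDerivAt.comp z (hM.hasFDerivAt_reparam z)
  refine lipschitzOnWith_of_fderiv_le (convex_closedBall _ _)
    (fun z hz => (hderiv (hM.reparam_mem_nbhd hz)).differentiableAt) fun z hz u => ?_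
  have hz' := hM.reparam_mem_nbhd hz
  rw [delta01, if_pos hsmooth] at hη
  have hle := inner_le_of_dualNorm_le hM.posDef_fisher (by positivity)
    ((le_iSup₂_of_le _ hz' le_rfl).trans hη) (whitening hM.posDef_smul_fisher u)
  rw [gradient, InnerProductSpace.toDual_symm_apply, hM.wnorm_fisher_whitening] at hle
  rw [(hderiv hz').fderiv]
  refine hle.trans_eq ?_
  field_simp

end Whitened

end GLM.Regular

lemma tail_exponent_le {C D r g η l s : ℝ} (hD : 1 ≤ D) (hg : g ≤ r * √D) (hη : η ≤ 1)
    (hl : l ≤ 0) (h : C + r + 2 - l ≤ s ^ 2 / 8) :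
    C * D + g * √D + D + η * √D - l ≤ (s * √D) ^ 2 / 8 := by
  have hsqrt : √D * √D = D := Real.mul_self_sqrt (by linarith)
  have hg' : g * √D ≤ r * D := by
    calc g * √D ≤ r * √D * √D := mul_le_mul_of_nonneg_right hg (Real.sqrt_nonneg D)
      _ = r * D := by rw [mul_assoc, hsqrt]
  have hη' : η * √D ≤ D := by
    calc η * √D ≤ 1 * √D := mul_le_mul_of_nonneg_right hη (Real.sqrt_nonneg D)
      _ ≤ D := by nlinarith [Real.one_le_sqrt.2 hD]
  have hl' : l * D ≤ l := by nlinarith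
  calc C * D + g * √D + D + η * √D - l ≤ (C + r + 2 - l) * D := by linarith
    _ ≤ s ^ 2 / 8 * D := by gcongr
    _ = (s * √D) ^ 2 / 8 := by rw [mul_pow, sq √D, hsqrt, div_mul_eq_mul_div]

namespace GLM.Regular

section Transfer

variable {n d k : ℕ} {M : GLM n d k} (hM : M.Regular)

/-- The unnormalized posterior in the coordinates `reparam`, up to the constant Jacobian. -/
noncomputable def whitenedPosterior (Y : Fin n → EuclideanSpace ℝ (Fin k)) :
    Measure (EuclideanSpace ℝ (Fin d)) :=
  gibbsMeasure (hM.reparam ⁻¹' M.Theta) (fun z => (n : ℝ) * M.nll Y (hM.reparam z))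
    fun z => M.prior (hM.reparam z)

lemma exists_map_whitenedPosterior_eq_smul (Y : Fin n → EuclideanSpace ℝ (Fin k)) :
    ∃ c : ℝ≥0∞, c ≠ 0 ∧ c ≠ ∞ ∧
      (hM.whitenedPosterior Y).map hM.reparam.toMeasurableEquiv = c • M.unnormPosterior Y := by
  obtain ⟨c, hc, hc', hvol⟩ :=
    exists_map_add_clm_eq_smul volume M.truth (whitening hM.posDef_smul_fisher)
  refine ⟨c, hc, hc', ?_⟩
  have hmap : volume.map hM.reparam.toMeasurableEquiv = c • volume := hvol
  calc (hM.whitenedPosterior Y).map hM.reparam.toMeasurableEquiv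
      = ((volume.map hM.reparam.toMeasurableEquiv).restrict M.Theta).withDensity fun θ =>
          ENNReal.ofReal (Real.exp (-((n : ℝ) * M.nll Y θ)) * M.prior θ) := by
        rw [MeasurableEquiv.restrict_map, ← map_withDensity_comp]
        rfl
    _ = c • M.unnormPosterior Y := by
        simp only [hmap, Measure.restrict_smul, withDensity_smul_measure, unnormPosterior, neg_mul]

lemma posterior_eq_map (Y : Fin n → EuclideanSpace ℝ (Fin k)) :
    M.posterior Y = ((hM.whitenedPosterior Y Set.univ)⁻¹ • hM.whitenedPosterior Y).map
      hM.reparam.toMeasurableEquiv := by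
  obtain ⟨c, hc, hc', hmap⟩ := hM.exists_map_whitenedPosterior_eq_smul Y
  rw [posterior, ← inv_univ_smul_smul hc hc', ← hmap, MeasurableEquiv.map_apply, Set.preimage_univ,
    Measure.map_smul]

lemma bvmGaussian_reparam (y : EuclideanSpace ℝ (Fin d)) :
    M.bvmGaussian (hM.reparam y) =
      ((stdGaussian (EuclideanSpace ℝ (Fin d))).map (y + ·)).map hM.reparam.toMeasurableEquiv :=
  multivariateGaussian_inv_whitening hM.posDef_smul_fisher M.truth y

lemma isUniqueMLE_reparam {Y : Fin n → EuclideanSpace ℝ (Fin k)} {y : EuclideanSpace ℝ (Fin d)}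
    (hy : hM.reparam y ∈ M.Theta)
    (hmin : ∀ z ∈ hM.reparam ⁻¹' M.Theta, z ≠ y →
      (n : ℝ) * M.nll Y (hM.reparam y) < n * M.nll Y (hM.reparam z)) :
    M.IsUniqueMLE Y (hM.reparam y) := by
  refine ⟨hy, fun θ hθ hne => ?_⟩
  obtain ⟨z, rfl⟩ := hM.reparam.surjective θ
  exact lt_of_mul_lt_mul_left (hmin z hθ (ne_of_apply_ne _ hne)) n.cast_nonneg

end Transfer

section Nonasymptotic

variable {n d k : ℕ} {M : GLM n d k} (hM : M.Regular)
include hM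

lemma delta3_le {s : ℝ} {κ : NNReal} (h : M.delta3 s * (d / ENNReal.ofReal √n) ≤ κ) :
    M.delta3 s ≤ ENNReal.ofReal (κ / (d / √n)) := by
  have hd : (0 : ℝ) < d := Nat.cast_pos.2 hM.d_pos
  have hn : 0 < √(n : ℝ) := Real.sqrt_pos.2 (Nat.cast_pos.2 hM.n_pos)
  rw [← ENNReal.ofReal_natCast d, ← ENNReal.ofReal_div_of_pos hn] at h
  rwa [ENNReal.ofReal_div_of_pos (by positivity), ENNReal.ofReal_coe_nnreal,
    ENNReal.le_div_iff_mul_le (.inl (ENNReal.ofReal_pos.2 (by positivity)).ne')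
      (.inl ENNReal.ofReal_ne_top)]

lemma delta01_le {s : ℝ} {η : NNReal} (h : M.delta01 s / ENNReal.ofReal √n ≤ η) :
    M.delta01 s ≤ ENNReal.ofReal (η * √n) := by
  have hn : 0 < √(n : ℝ) := Real.sqrt_pos.2 (Nat.cast_pos.2 hM.n_pos)
  rw [ENNReal.ofReal_mul η.coe_nonneg, ENNReal.ofReal_coe_nnreal]
  exact (ENNReal.div_le_iff (ENNReal.ofReal_pos.2 hn).ne' ENNReal.ofReal_ne_top).1 h

variable {s r C : ℝ} {κ η : NNReal} {Y : Fin n → EuclideanSpace ℝ (Fin k)}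

lemma laplaceRegime {τ : NNReal} (hτ : (τ : ℝ) = 5 * κ * s / √d) (hτ8 : τ ≤ 1 / 8)
    (hscore : ‖hM.whitenedScore Y‖ ≤ r * √d) (hs : 8 ≤ s) (hrs : 8 * r ≤ s)
    (hsub : M.nbhd s ⊆ M.Theta)
    (h3 : M.delta3 s * (d / ENNReal.ofReal √n) ≤ κ)
    (h01 : M.delta01 s / ENNReal.ofReal √n ≤ η)
    (hprior : ∀ θ ∈ M.Theta, M.prior θ ≤ Real.exp (C * d) * M.prior M.truth) :
    LaplaceRegime (hM.reparam ⁻¹' M.Theta) (fun z => (n : ℝ) * M.nll Y (hM.reparam z))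
      (fun z => M.prior (hM.reparam z)) (s * √d) (C * d) τ η where
  measurableSet := (hM.isOpen_Theta.preimage hM.reparam.continuous).measurableSet
  convexOn := hM.convexOn_nll_reparam Y
  pos_radius := by
    have : (0 : ℝ) < d := Nat.cast_pos.2 hM.d_pos
    positivity
  closedBall_subset z hz := hsub (hM.reparam_mem_nbhd hz)
  sqrt_finrank_le := by
    rw [finrank_euclideanSpace_fin]
    gcongr
  norm_fderiv_le := by
    rw [hM.fderiv_nll_reparam_zero]
    calc 8 * _ ≤ 8 * (r * √d) := by gcongr
      _ = 8 * r * √d := by ring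
      _ ≤ s * √d := by gcongr
  nearlyQuadratic := by
    have hd : 0 < √(d : ℝ) := Real.sqrt_pos.2 (Nat.cast_pos.2 hM.d_pos)
    have hn : 0 < √(n : ℝ) := Real.sqrt_pos.2 (Nat.cast_pos.2 hM.n_pos)
    refine hM.nearlyQuadratic_nll (by positivity) (by positivity) hsub (hM.delta3_le h3) ?_ Y
    rw [hτ]
    nth_rewrite 1 [← Real.sq_sqrt d.cast_nonneg]
    apply le_of_eq
    field_simp
  curvature_le := hτ8
  pos_prior z hz := hM.prior_pos _ hz
  lipschitzOnWith_log := hM.lipschitzOnWith_log_prior (hM.delta01_le h01)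
  prior_le z hz := by
    rw [reparam_zero]
    exact hprior _ hz

lemma mem_bvmEvent {e ρ : ℝ}
    (hscore : ‖hM.whitenedScore Y‖ ≤ r * √d) (hs : 8 ≤ s) (hrs : 8 * r ≤ s)
    (hsub : M.nbhd s ⊆ M.Theta)
    (h3 : M.delta3 s * (d / ENNReal.ofReal √n) ≤ κ)
    (h01 : M.delta01 s / ENNReal.ofReal √n ≤ η)
    (hprior : ∀ θ ∈ M.Theta, M.prior θ ≤ Real.exp (C * d) * M.prior M.truth)
    (he : 0 < e) (he' : e ≤ 1 / 4) (hexp : C + r + 2 - Real.log e ≤ s ^ 2 / 8)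
    (hse : 4 ≤ e * s ^ 2) (hρ : 0 < ρ) (hρ' : ρ ≤ 1 / 8) (hηρ : η + 10 * s ^ 2 * κ ≤ ρ) :
    Y ∈ M.bvmEvent (8 * ρ + 4 * e) := by
  have hd : (1 : ℝ) ≤ d := Nat.one_le_cast.2 hM.d_pos
  have hsqrt : 1 ≤ √(d : ℝ) := Real.one_le_sqrt.2 hd
  have hdsq : √(d : ℝ) ^ 2 = d := Real.sq_sqrt d.cast_nonneg
  have : 0 ≤ (κ : ℝ) * s := by positivity
  obtain ⟨τ, hτ⟩ : ∃ τ : NNReal, (τ : ℝ) = 5 * κ * s / √d := ⟨⟨_, by positivity⟩, rfl⟩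
  have hτκ : (τ : ℝ) ≤ 1 / 8 := by
    rw [hτ]
    refine (div_le_self (by positivity) hsqrt).trans ?_
    nlinarith [η.coe_nonneg]
  have hlap : LaplaceRegime _ _ _ (s * √d) (C * d) τ η :=
    hM.laplaceRegime hτ (by exact_mod_cast hτκ) hscore hs hrs hsub h3 h01 hprior
  have hτs : 2 * τ * (s * √d) = 10 * s ^ 2 * κ := by
    rw [hτ]
    field_simp
    ring
  obtain ⟨y, hy, hmin, htv⟩ := hlap.exists_tvDist_gibbsMeasure_le he he'
    (by rw [finrank_euclideanSpace_fin, mul_pow, hdsq]; nlinarith)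
    (by
      rw [hM.fderiv_nll_reparam_zero, finrank_euclideanSpace_fin]
      exact tail_exponent_le hd hscore (by nlinarith)
        (Real.log_nonpos he.le (by linarith)) hexp) hρ hρ' (by rwa [hτs])
  have : NeZero (hM.whitenedPosterior Y) := hlap.neZero_gibbsMeasure
  have : IsFiniteMeasure (hM.whitenedPosterior Y) := hlap.isFiniteMeasure_gibbsMeasure
  refine ⟨hM.reparam y, hM.isUniqueMLE_reparam hy hmin, ?_, ?_⟩
  · rw [hM.posterior_eq_map]
    exact Measure.isProbabilityMeasure_map hM.reparam.toMeasurableEquiv.measurable.aemeasurable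
  · rw [hM.posterior_eq_map, hM.bvmGaussian_reparam, tvDist_map_measurableEquiv]
    exact htv

end Nonasymptotic

end GLM.Regular

namespace GLM.Regular

section Score

variable {n d k : ℕ} {M : GLM n d k} (hM : M.Regular)
include hM

lemma law_eq_pi {θ : EuclideanSpace ℝ (Fin d)} (hθ : θ ∈ M.Theta) :
    M.law θ = Measure.pi fun i => M.base.tilted (inner ℝ (M.pred i θ)) := by
  simp only [law, ExpFam.withDensity_density hM.base_ne_zero (hθ _)]

lemma isProbabilityMeasure_law {θ : EuclideanSpace ℝ (Fin d)} (hθ : θ ∈ M.Theta) :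
    IsProbabilityMeasure (M.law θ) := by
  have (i : Fin n) := ExpFam.isProbabilityMeasure_tilted_inner hM.base_ne_zero (hθ i)
  rw [hM.law_eq_pi hθ]
  infer_instance

lemma fderiv_logPartition_apply {θ : EuclideanSpace ℝ (Fin d)} (hθ : θ ∈ M.Theta)
    (u : EuclideanSpace ℝ (Fin d)) :
    fderiv ℝ M.logPartition θ u =
      ∑ i, fderiv ℝ (ExpFam.psi M.base) (M.pred i θ) (M.pred i u) := by
  have hterm (i : Fin n) : HasFDerivAt (fun θ => ExpFam.psi M.base (M.pred i θ))
      ((fderiv ℝ (ExpFam.psi M.base) (M.pred i θ)).comp (M.predL i)) θ :=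
    ((ExpFam.contDiffAt_psi hM.base_ne_zero hM.isRegular 1 (hθ i)).differentiableAt
      (by simp)).hasFDerivAt.comp θ (M.predL i).hasFDerivAt
  have hsum : HasFDerivAt M.logPartition
      (∑ i, (fderiv ℝ (ExpFam.psi M.base) (M.pred i θ)).comp (M.predL i)) θ :=
    HasFDerivAt.fun_sum fun i _ => hterm i
  simp [hsum.fderiv, pred_eq_predL]

lemma memLp_inner_pred_eval {θ : EuclideanSpace ℝ (Fin d)} (hθ : θ ∈ M.Theta)
    (u : EuclideanSpace ℝ (Fin d)) (i : Fin n) :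
    MemLp (fun Y : Fin n → EuclideanSpace ℝ (Fin k) => inner ℝ (M.pred i u) (Y i)) 2 (M.law θ) := by
  have (i : Fin n) := ExpFam.isProbabilityMeasure_tilted_inner hM.base_ne_zero (hθ i)
  rw [hM.law_eq_pi hθ]
  exact (ExpFam.memLp_inner_tilted hM.isRegular (hθ i) _).comp_measurePreserving
    (measurePreserving_eval (fun i => M.base.tilted (inner ℝ (M.pred i θ))) i)

lemma memLp_suffStat {θ : EuclideanSpace ℝ (Fin d)} (hθ : θ ∈ M.Theta)
    (u : EuclideanSpace ℝ (Fin d)) : MemLp (fun Y => M.suffStat Y u) 2 (M.law θ) := by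
  simp_rw [suffStat_apply]
  exact memLp_finsetSum _ fun i _ => hM.memLp_inner_pred_eval hθ u i

lemma integral_suffStat {θ : EuclideanSpace ℝ (Fin d)} (hθ : θ ∈ M.Theta)
    (u : EuclideanSpace ℝ (Fin d)) :
    ∫ Y, M.suffStat Y u ∂M.law θ = fderiv ℝ M.logPartition θ u := by
  have (i : Fin n) := ExpFam.isProbabilityMeasure_tilted_inner hM.base_ne_zero (hθ i)
  have := hM.isProbabilityMeasure_law hθ
  simp_rw [suffStat_apply]
  rw [integral_finsetSum _ fun i _ => (hM.memLp_inner_pred_eval hθ u i).integrable (by norm_num),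
    hM.fderiv_logPartition_apply hθ]
  refine Finset.sum_congr rfl fun i _ => ?_
  rw [hM.law_eq_pi hθ,
    ← ExpFam.integral_inner_tilted hM.base_ne_zero hM.isRegular (hθ i)]
  exact integral_comp_eval
    (ExpFam.memLp_inner_tilted hM.isRegular (hθ i) (M.pred i u)).aestronglyMeasurable

lemma variance_suffStat {θ : EuclideanSpace ℝ (Fin d)} (hθ : θ ∈ M.Theta)
    (u : EuclideanSpace ℝ (Fin d)) :
    Var[fun Y => M.suffStat Y u; M.law θ] =
      iteratedFDeriv ℝ 2 M.logPartition θ fun _ => u := by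
  have (i : Fin n) := ExpFam.isProbabilityMeasure_tilted_inner hM.base_ne_zero (hθ i)
  have hsum : (fun Y => M.suffStat Y u) = ∑ i, fun Y => inner ℝ (M.pred i u) (Y i) := by
    ext Y
    rw [suffStat_apply, Finset.sum_apply]
  rw [hsum, hM.law_eq_pi hθ,
    variance_sum_pi fun i => ExpFam.memLp_inner_tilted hM.isRegular (hθ i) (M.pred i u),
    hM.iteratedFDeriv_logPartition 2 hθ]
  exact Finset.sum_congr rfl fun i _ =>
    ExpFam.variance_inner_tilted hM.base_ne_zero hM.isRegular (hθ i) _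

lemma integrable_score_sq (u : EuclideanSpace ℝ (Fin d)) :
    Integrable (fun Y => M.score Y u ^ 2) (M.law M.truth) := by
  have := hM.isProbabilityMeasure_law hM.truth_mem
  exact ((memLp_const _).sub (hM.memLp_suffStat hM.truth_mem u)).integrable_sq

lemma integral_score_sq (u : EuclideanSpace ℝ (Fin d)) :
    ∫ Y, M.score Y u ^ 2 ∂M.law M.truth = u.ofLp ⬝ᵥ ((n : ℝ) • M.fisher) *ᵥ u.ofLp := by
  have hmem := hM.memLp_suffStat hM.truth_mem u
  rw [← hM.iteratedFDeriv_two_logPartition_truth, ← hM.variance_suffStat hM.truth_mem,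
    variance_eq_integral hmem.aemeasurable, hM.integral_suffStat hM.truth_mem]
  exact integral_congr_ae (ae_of_all _ fun Y => sub_sq_comm _ _)

lemma norm_whitenedScore_sq (Y : Fin n → EuclideanSpace ℝ (Fin k)) :
    ‖hM.whitenedScore Y‖ ^ 2 = ∑ j, M.score Y (whitening hM.posDef_smul_fisher
      (stdOrthonormalBasis ℝ (EuclideanSpace ℝ (Fin d)) j)) ^ 2 :=
  (stdOrthonormalBasis ℝ (EuclideanSpace ℝ (Fin d))).norm_dual _

lemma integrable_norm_whitenedScore_sq :
    Integrable (fun Y => ‖hM.whitenedScore Y‖ ^ 2) (M.law M.truth) := by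
  simp_rw [norm_whitenedScore_sq]
  exact integrable_finsetSum _ fun j _ => hM.integrable_score_sq _

lemma integral_norm_whitenedScore_sq :
    ∫ Y, ‖hM.whitenedScore Y‖ ^ 2 ∂M.law M.truth = d := by
  simp_rw [norm_whitenedScore_sq]
  rw [integral_finsetSum _ fun j _ => hM.integrable_score_sq _]
  simp [hM.integral_score_sq, dotProduct_mulVec_whitening]

lemma law_norm_whitenedScore_gt_le {r : ℝ} (hr : 0 < r) :
    M.law M.truth {Y | r * √d < ‖hM.whitenedScore Y‖} ≤ ENNReal.ofReal (1 / r ^ 2) := by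
  have := hM.isProbabilityMeasure_law hM.truth_mem
  have hd : (0 : ℝ) < d := Nat.cast_pos.2 hM.d_pos
  have hmarkov := mul_meas_ge_le_integral_of_nonneg (ae_of_all _ fun Y => sq_nonneg _)
    hM.integrable_norm_whitenedScore_sq (r ^ 2 * d)
  rw [hM.integral_norm_whitenedScore_sq] at hmarkov
  have hsub : {Y | r * √d < ‖hM.whitenedScore Y‖} ⊆
      {Y | r ^ 2 * d ≤ ‖hM.whitenedScore Y‖ ^ 2} := by
    intro Y hY
    calc r ^ 2 * d = (r * √d) ^ 2 := by rw [mul_pow, Real.sq_sqrt hd.le]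
      _ ≤ ‖hM.whitenedScore Y‖ ^ 2 := pow_le_pow_left₀ (by positivity) (le_of_lt hY) 2
  refine (measure_mono hsub).trans ?_
  rw [ENNReal.le_ofReal_iff_toReal_le (measure_ne_top _ _) (by positivity),
    le_div_iff₀ (by positivity)]
  refine le_of_mul_le_mul_right ?_ hd
  rw [measureReal_def] at hmarkov
  linarith

end Score

end GLM.Regular

lemma exists_measurableSet_subset_tendsto_one {Ω : ℕ → Type*} [∀ n, MeasurableSpace (Ω n)]
    {P : (n : ℕ) → Measure (Ω n)} (hP : ∀ᶠ n in atTop, IsProbabilityMeasure (P n))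
    {B : (n : ℕ) → Set (Ω n)} (hB : Tendsto (fun n => P n (B n)ᶜ) atTop (𝓝 0)) :
    ∃ A : (n : ℕ) → Set (Ω n), (∀ n, MeasurableSet (A n)) ∧ (∀ n, A n ⊆ B n) ∧
      Tendsto (fun n => P n (A n)) atTop (𝓝 1) := by
  refine ⟨fun n => (toMeasurable (P n) (B n)ᶜ)ᶜ, fun n => (measurableSet_toMeasurable _ _).compl,
    fun n => Set.compl_subset_comm.1 (subset_toMeasurable _ _), ?_⟩
  have hsub : Tendsto (fun n => 1 - P n (B n)ᶜ) atTop (𝓝 1) := by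
    simpa using ENNReal.Tendsto.sub tendsto_const_nhds hB (.inl ENNReal.one_ne_top)
  refine hsub.congr' ?_
  filter_upwards [hP] with n hn
  rw [prob_compl_eq_one_sub (measurableSet_toMeasurable _ _), measure_toMeasurable]

lemma tendsto_ofReal_one_div_sq :
    Tendsto (fun r : ℝ => ENNReal.ofReal (1 / r ^ 2)) atTop (𝓝 0) := by
  simpa using ENNReal.tendsto_ofReal
    (tendsto_const_nhds.div_atTop (tendsto_pow_atTop (α := ℝ) two_ne_zero) (a := 1))

namespace GLM

section Asymptotics

lemma bvmEvent_mono {n d k : ℕ} {M : GLM n d k} : Monotone M.bvmEvent :=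
  fun _ _ h _ ⟨y, hy, hprob, hle⟩ => ⟨y, hy, hprob, hle.trans h⟩

lemma Regular.prior_le_of_M0_le {n d k : ℕ} {M : GLM n d k} (hM : M.Regular) {C : ℝ}
    (hC : M.M0 ≤ (C : EReal)) {θ : EuclideanSpace ℝ (Fin d)} (hθ : θ ∈ M.Theta) :
    M.prior θ ≤ Real.exp (C * d) * M.prior M.truth := by
  have hcast : (d : EReal) = ((d : ℝ) : EReal) := rfl
  rw [M0, hcast, EReal.div_le_iff_le_mul (by exact_mod_cast hM.d_pos) (EReal.coe_ne_top _),
    ← EReal.coe_mul, ← EReal.exp_le_exp_iff, ENNReal.exp_log, EReal.exp_coe] at hC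
  have hratio := (le_iSup₂ (f := fun θ (_ : θ ∈ M.Theta) =>
    ENNReal.ofReal (M.prior θ / M.prior M.truth)) θ hθ).trans hC
  rwa [ENNReal.ofReal_le_ofReal_iff (Real.exp_nonneg _),
    div_le_iff₀ (hM.prior_pos _ hM.truth_mem), mul_comm (d : ℝ)] at hratio

lemma exists_radius {e : ℝ} (he : 0 < e) (C r : ℝ) :
    ∃ s : ℝ, 8 ≤ s ∧ 8 * r ≤ s ∧ C + r + 2 - Real.log e ≤ s ^ 2 / 8 ∧ 4 ≤ e * s ^ 2 := by
  have hsq : Tendsto (fun s : ℝ => s ^ 2) atTop atTop := tendsto_pow_atTop two_ne_zero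
  exact ((eventually_ge_atTop 8).and ((eventually_ge_atTop (8 * r)).and
    (((hsq.atTop_div_const (by norm_num)).eventually_ge_atTop _).and
      ((hsq.const_mul_atTop he).eventually_ge_atTop 4)))).exists

variable {d k : ℕ → ℕ} {M : (n : ℕ) → GLM n (d n) (k n)} {C : ℝ}
  (hC : ∀ᶠ n in atTop, (M n).M0 ≤ (C : EReal))
  (hnbhd : ∀ s : ℝ, 0 ≤ s → ∀ᶠ n in atTop, (M n).nbhd s ⊆ (M n).Theta)
  (hdelta01 : ∀ s : ℝ, 0 ≤ s →
    Tendsto (fun n => (M n).delta01 s / ENNReal.ofReal (√(n : ℝ))) atTop (𝓝 0))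
  (hdelta3 : ∀ s : ℝ, 0 ≤ s →
    Tendsto (fun n => (M n).delta3 s * ((d n : ℝ≥0∞) / ENNReal.ofReal (√(n : ℝ))))
      atTop (𝓝 0))
  {ε : ℝ} (hε : 0 < ε)
include hC hnbhd hdelta01 hdelta3 hε

lemma eventually_mem_bvmEvent (r : ℝ) :
    ∀ᶠ n in atTop, ∀ hM : (M n).Regular, ∀ Y, ‖hM.whitenedScore Y‖ ≤ r * √(d n) →
      Y ∈ (M n).bvmEvent ε := by
  have : 0 < min ε 1 := lt_min hε one_pos
  set a := min ε 1 / 16 with ha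
  have ha0 : 0 < a := by positivity
  have haε : 8 * a + 4 * a ≤ ε := by linarith [min_le_left ε 1]
  have ha1 : a ≤ 1 / 16 := by linarith [min_le_right ε 1]
  obtain ⟨s, hs, hrs, hexp, hse⟩ := exists_radius ha0 C r
  have hs0 : 0 ≤ s := by linarith
  have hη : 0 < a / 2 := by positivity
  have hκ : 0 < a / (20 * s ^ 2) := by positivity
  filter_upwards [hC, hnbhd s hs0,
    (hdelta01 s hs0).eventually_le_const (ENNReal.ofReal_pos.2 hη),
    (hdelta3 s hs0).eventually_le_const (ENNReal.ofReal_pos.2 hκ)] with n hC hsub h01 h3 hM Y hY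
  refine bvmEvent_mono haε (hM.mem_bvmEvent hY hs hrs hsub h3 h01
    (fun θ hθ => hM.prior_le_of_M0_le hC hθ) ha0 (by linarith) hexp hse ha0 (by linarith) ?_)
  rw [Real.coe_toNNReal _ hη.le, Real.coe_toNNReal _ hκ.le]
  apply le_of_eq
  field_simp
  ring

lemma tendsto_law_compl_bvmEvent (hM : ∀ᶠ n in atTop, (M n).Regular) :
    Tendsto (fun n => (M n).law (M n).truth ((M n).bvmEvent ε)ᶜ) atTop (𝓝 0) := by
  refine ENNReal.tendsto_nhds_zero.2 fun δ hδ => ?_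
  obtain ⟨r, hrδ, hr⟩ :=
    ((tendsto_ofReal_one_div_sq.eventually_le_const hδ).and (eventually_gt_atTop 0)).exists
  filter_upwards [hM, eventually_mem_bvmEvent hC hnbhd hdelta01 hdelta3 hε r] with n hM hmem
  refine (measure_mono fun Y hY => ?_).trans ((hM.law_norm_whitenedScore_gt_le hr).trans hrδ)
  exact not_le.1 fun hle => hY (hmem hM Y hle)

end Asymptotics

end GLM

theorem corollary4p4 (d k : ℕ → ℕ) (M : (n : ℕ) → GLM n (d n) (k n))
    (hd : ∀ n, 0 < n → 0 < d n)
    (hreg : ∀ n, 0 < n → ExpFam.IsRegular (M n).base)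
    (hmin : ∀ n, 0 < n → ExpFam.IsMinimal (M n).base)
    (htruth : ∀ n, 0 < n → (M n).truth ∈ (M n).Theta)
    (hprior_meas : ∀ n, 0 < n → AEMeasurable (M n).prior (volume.restrict (M n).Theta))
    (hprior_pos : ∀ n, 0 < n → ∀ θ ∈ (M n).Theta, 0 < (M n).prior θ)
    (hspan : ∀ n, 0 < n →
      Submodule.span ℝ (Set.range fun p : Fin n × Fin (k n) => ((M n).X p.1).col p.2) = ⊤)
    (hM0 : ∃ C : ℝ, ∀ᶠ n in atTop, (M n).M0 ≤ (C : EReal))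
    (hnbhd : ∀ s : ℝ, 0 ≤ s → ∀ᶠ n in atTop, (M n).nbhd s ⊆ (M n).Theta)
    (hdelta01 : ∀ s : ℝ, 0 ≤ s →
      Tendsto (fun n => (M n).delta01 s / ENNReal.ofReal (√(n : ℝ))) atTop (𝓝 0))
    (hdelta3 : ∀ s : ℝ, 0 ≤ s →
      Tendsto (fun n => (M n).delta3 s * ((d n : ℝ≥0∞) / ENNReal.ofReal (√(n : ℝ))))
        atTop (𝓝 0)) :
    ∀ ε : ℝ, 0 < ε →
      ∃ A : (n : ℕ) → Set (Fin n → EuclideanSpace ℝ (Fin (k n))),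
        (∀ n, MeasurableSet (A n)) ∧ (∀ n, A n ⊆ (M n).bvmEvent ε) ∧
        Tendsto (fun n => (M n).law (M n).truth (A n)) atTop (𝓝 1) := by
  intro ε hε
  have hregular : ∀ᶠ n in atTop, (M n).Regular := by
    filter_upwards [eventually_gt_atTop 0] with n hn
    exact ⟨hn, hd n hn, hreg n hn, hmin n hn, htruth n hn, hspan n hn, hprior_pos n hn⟩
  obtain ⟨C, hC⟩ := hM0
  exact exists_measurableSet_subset_tendsto_one
    (hregular.mono fun n hM => hM.isProbabilityMeasure_law hM.truth_mem)
    (GLM.tendsto_law_compl_bvmEvent hC hnbhd hdelta01 hdelta3 hε hregular)
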